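/- **Setting.** Let $(\Omega,\mathcal F,\mathbb P)$ be a probability space; $B\in\Omega$ denotes a realisation of the random environment. Let $\nu_1,\nu_2$ be probability densities on $\mathbb R$ with all polynomial moments finite, put $\nu(x,z)=\nu_1(x)\nu_2(z)$, let $\beta,\gamma,\ell>0$, let $m$ be a positive integer with $m>3+\frac{144\beta}{\min(24\gamma,1)}$, and set $\sigma_n=\ell n^{-1/(2\beta)}$ for $n\ge 1$. Write $a_n\precsim b_n$ if there is $C>0$ with $a_n\le C b_n$ for all $n\ge1$. All random functions below are jointly measurable. For each $n\ge 1$ let $q_n(x,\cdot\,|B)$, $x\in\mathbb R$, be (possibly environment-dependent) probability densities on $\mathbb R$. For a target density $\xi(\cdot\,|B)$ let $$\rho_n(x,y\,|B)=\log\frac{\xi(y|B)\,q_n(y,x|B)}{\xi(x|B)\,q_n(x,y|B)},$$ with $\rho_n(x,y\,|B)=0$ if $\xi(x|B)q_n(x,y|B)$ and $\xi(y|B)q_n(y,x|B)$ are not both positive. **Assumptions.** (A) $\xi(x|B)=\exp(K(x|B))\,\nu_1(x)$, where $(K(x|B):x\in\mathbb R)$ is a centred Gaussian process with variance function $k(x)$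 and $\int_{\mathbb R}\exp(2m^2k(x))\nu_1(x)\,dx<\infty$. (B) For all $n\ge 1$ and all $x,z$, almost surely $\sigma_nq_n(x,x+\sigma_nz|B)=L_n(x,z|B)\nu_2(z)$, where $\iint \mathbb E\big[|L_n(x,z|B)-1|^{4m}\big]\nu(x,z)\,dx\,dz\precsim\sigma_n^{4m\gamma}$. (C) For all $n\ge 1$ and all $x,z$, almost surely $\rho_n(x,x+\sigma_nz|B)=M_n(x,z|B)+\Delta_n(x,z|B)$, where for each $n$ the process $(M_n(x,z|B))_{x,z\in\mathbb R}$ is centred Gaussian and jointly Gaussian with $K$, $M_n(x,z|B)$ has variance $h(x,z)\sigma_n^{2\beta}$ for a function $h$ of at most polynomial growth (not depending on $n$), and $\iint\mathbb E\big[|\Delta_n(x,z|B)|^{8m}\big]\nu(x,z)\,dx\,dz\precsim\sigma_n^{8m\beta+8m\gamma}$. (D) There are measurable sets $\mathcal S_n\subset\mathbb R^4$ with $\int_{\mathcal S_n^c}\nu(x_1,z_1)\nu(x_2,z_2)\,dx_1dz_1dx_2dz_2\precsim\sigma_n^{1/2}$ and fixed polynomials $g_1,g_2$ such that, for all $n\ge1$,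 $|\mathbb E[M_n(x_1,z_1|B)M_n(x_2,z_2|B)]|\le g_1(x_1,z_1,x_2,z_2)\,\sigma_n^{2\beta+\gamma}$ for $(x_1,z_1,x_2,z_2)\in\mathcal S_n$, and $|\mathbb E[M_n(x_1,z_1|B)K(x_2|B)]|\le g_2(x_1,z_1,x_2)\,\sigma_n^{\beta+\gamma}$ for all real $x_1,z_1,x_2$. **Conclusion.** For almost every realisation $B$ of the environment: $0<\int\xi(x|B)\,dx<\infty$, all the integrals below converge (for every $n\ge1$), and, with $$\mathcal I_n(B)=\iint_{\mathbb R^2}\rho_n^2(x,y|B)\,\xi(x|B)\,q_n(x,y|B)\,dx\,dy,$$ $$\sigma_n^{-2\beta}\,\mathcal I_n(B)\ \xrightarrow[n\to\infty]{}\ \iint_{\mathbb R^2}h(x,z)\,\xi(x|B)\,\nu_2(z)\,dx\,dz .$$ Consequently, with $\pi(x|B)=\xi(x|B)/\int\xi(u|B)\,du$ and $\mathbb E_{\pi,q_n}[\rho_n^2|B]=\iint\rho_n^2(x,y|B)\,\pi(x|B)\,q_n(x,y|B)\,dx\,dy$, $$\sigma_n^{-2\beta}\,\mathbb E_{\pi,q_n}[\rho_n^2|B]\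 \xrightarrow[n\to\infty]{}\ \iint_{\mathbb R^2}h(x,z)\,\pi(x|B)\,\nu_2(z)\,dx\,dz .$$ -/

import Mathlib

open MeasureTheory ProbabilityTheory Filter Topology
open scoped ENNReal

/-- `a ≾ b`: there is a constant `C > 0` with `a n ≤ C * b n` for all positive integers `n`.
The left-hand side is an integral of a nonnegative function, so it takes values in `[0, ∞]`. -/
def Precsim (a : ℕ → ℝ≥0∞) (b : ℕ → ℝ) : Prop :=
  ∃ C : ℝ, 0 < C ∧ ∀ n : ℕ, 1 ≤ n → a n ≤ ENNReal.ofReal (C * b n)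

/-- The scale `σ_n = ℓ n^{-1/(2β)}`. -/
noncomputable def scale (ℓ β : ℝ) (n : ℕ) : ℝ := ℓ * (n : ℝ) ^ (-(1 / (2 * β)))

/-- A probability density on the real line, all of whose polynomial moments are finite. -/
structure IsDensityWithMoments (ν : ℝ → ℝ) : Prop where
  measurable : Measurable ν
  nonneg : ∀ x, 0 ≤ ν x
  integral_eq_one : ∫ x, ν x = 1
  moments : ∀ k : ℕ, Integrable (fun x => |x| ^ k * ν x)

/-- The logarithm of the Metropolis-Hastings acceptance ratio for the (possibly unnormalised)
target density `f` and the proposal density `q`. As usual it is set to be `0` at the pairs where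
`f(x) q(x,y)` and `f(y) q(y,x)` are not both positive. -/
noncomputable def logMHRatio (f : ℝ → ℝ) (q : ℝ → ℝ → ℝ) (x y : ℝ) : ℝ :=
  open Classical in
  if 0 < f x * q x y ∧ 0 < f y * q y x then Real.log ((f y * q y x) / (f x * q x y)) else 0

/-- The integrand `ρ²(x,y) f(x) q(x,y)`. -/
noncomputable def sqRatioIntegrand (f : ℝ → ℝ) (q : ℝ → ℝ → ℝ) (p : ℝ × ℝ) : ℝ :=
  logMHRatio f q p.1 p.2 ^ 2 * f p.1 * q p.1 p.2

/-- The second moment `∬ ρ²(x,y) f(x) q(x,y) dx dy` of the log acceptance ratio. -/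
noncomputable def sqRatioMoment (f : ℝ → ℝ) (q : ℝ → ℝ → ℝ) : ℝ :=
  ∫ p : ℝ × ℝ, sqRatioIntegrand f q p

section Environment

/- A point `ω : Ω` is a realisation of the random environment, and `P` is its law. -/
variable {Ω : Type*} [MeasurableSpace Ω]

/-- The unnormalised marginal target density `ξ(x|ω) = exp(K(x|ω)) ν₁(x)`. -/
noncomputable def unnormTarget (ν₁ : ℝ → ℝ) (K : ℝ → Ω → ℝ) (ω : Ω) (x : ℝ) : ℝ :=
  Real.exp (K x ω) * ν₁ x

/-- The normalised marginal target density `ξ(x|ω) / ∫ ξ(u|ω) du`. -/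
noncomputable def normTarget (ν₁ : ℝ → ℝ) (K : ℝ → Ω → ℝ) (ω : Ω) (x : ℝ) : ℝ :=
  unnormTarget ν₁ K ω x / ∫ u, unnormTarget ν₁ K ω u

/-- The log acceptance ratio `ρ_n(x,y|ω)`. It does not change when `ξ` is normalised. -/
noncomputable def envLogRatio (ν₁ : ℝ → ℝ) (K : ℝ → Ω → ℝ) (q : ℕ → ℝ → ℝ → Ω → ℝ)
    (n : ℕ) (x y : ℝ) (ω : Ω) : ℝ :=
  logMHRatio (unnormTarget ν₁ K ω) (fun x' y' => q n x' y' ω) x y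

/-- For each positive integer `n`, `q n x · ω` is a (random) proposal density. -/
structure IsProposalDensity (P : Measure Ω) (q : ℕ → ℝ → ℝ → Ω → ℝ) : Prop where
  measurable : ∀ n : ℕ, 1 ≤ n → Measurable (fun t : ℝ × ℝ × Ω => q n t.1 t.2.1 t.2.2)
  nonneg : ∀ n : ℕ, 1 ≤ n → ∀ x y ω, 0 ≤ q n x y ω
  mass_one : ∀ n : ℕ, 1 ≤ n → ∀ᵐ ω ∂P, ∀ x, ∫ y, q n x y ω = 1

/-- Mixed Gaussian perturbation of the log marginal target density: `K` is a centred Gaussian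
process with variance function `k`, and `exp (2 m² k)` is integrable with respect to `ν₁`. -/
structure GaussianPerturbation (P : Measure Ω) (ν₁ : ℝ → ℝ) (m : ℕ) (K : ℝ → Ω → ℝ) : Prop where
  measurable : Measurable (fun t : ℝ × Ω => K t.1 t.2)
  gaussian : IsGaussianProcess K P
  centred : ∀ x, ∫ ω, K x ω ∂P = 0
  exp_moment : Integrable (fun x => Real.exp (2 * (m : ℝ) ^ 2 * Var[K x; P]) * ν₁ x)

/-- Asymptotic behaviour of the marginal proposal, `σ_n q_n(x, x + σ_n z) = L_n(x, z) ν₂(z)`. -/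
def ProposalAsymptotics (P : Measure Ω) (ν₁ ν₂ : ℝ → ℝ) (β γ ℓ : ℝ) (m : ℕ)
    (q : ℕ → ℝ → ℝ → Ω → ℝ) : Prop :=
  ∃ L : ℕ → ℝ → ℝ → Ω → ℝ,
    (∀ n : ℕ, 1 ≤ n → Measurable (fun t : ℝ × ℝ × Ω => L n t.1 t.2.1 t.2.2)) ∧
    (∀ n : ℕ, 1 ≤ n → ∀ x z : ℝ, ∀ᵐ ω ∂P,
      scale ℓ β n * q n x (x + scale ℓ β n * z) ω = L n x z ω * ν₂ z) ∧
    Precsim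
      (fun n => ∫⁻ p : ℝ × ℝ, (∫⁻ ω, ENNReal.ofReal (|L n p.1 p.2 ω - 1| ^ (4 * m)) ∂P) *
        ENNReal.ofReal (ν₁ p.1 * ν₂ p.2))
      (fun n => scale ℓ β n ^ (4 * (m : ℝ) * γ))

/-- Approximate normality of the log Metropolis-Hastings ratio,
`ρ_n(x, x + σ_n z) = M_n(x, z) + Δ_n(x, z)`. -/
structure ApproxNormality (P : Measure Ω) (ν₁ ν₂ : ℝ → ℝ) (β γ ℓ : ℝ) (m : ℕ)
    (K : ℝ → Ω → ℝ) (q M : ℕ → ℝ → ℝ → Ω → ℝ) (h : ℝ → ℝ → ℝ) : Prop where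
  measurable : ∀ n : ℕ, 1 ≤ n → Measurable (fun t : ℝ × ℝ × Ω => M n t.1 t.2.1 t.2.2)
  /-- The process obtained by joining `K` (indexed by `x`) and `M_n` (indexed by `(x, z)`) is
  Gaussian. -/
  jointly_gaussian : ∀ n : ℕ, 1 ≤ n →
    IsGaussianProcess (Sum.elim K (fun p : ℝ × ℝ => M n p.1 p.2)) P
  centred : ∀ n : ℕ, 1 ≤ n → ∀ x z, ∫ ω, M n x z ω ∂P = 0
  variance_eq : ∀ n : ℕ, 1 ≤ n → ∀ x z, Var[M n x z; P] = h x z * scale ℓ β n ^ (2 * β)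
  poly_growth : ∃ C : ℝ, ∃ N : ℕ, ∀ x z, |h x z| ≤ C * (1 + |x| + |z|) ^ N
  remainder : ∃ Δ : ℕ → ℝ → ℝ → Ω → ℝ,
    (∀ n : ℕ, 1 ≤ n → Measurable (fun t : ℝ × ℝ × Ω => Δ n t.1 t.2.1 t.2.2)) ∧
    (∀ n : ℕ, 1 ≤ n → ∀ x z : ℝ, ∀ᵐ ω ∂P,
      envLogRatio ν₁ K q n x (x + scale ℓ β n * z) ω = M n x z ω + Δ n x z ω) ∧
    Precsim
      (fun n => ∫⁻ p : ℝ × ℝ, (∫⁻ ω, ENNReal.ofReal (|Δ n p.1 p.2 ω| ^ (8 * m)) ∂P) *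
        ENNReal.ofReal (ν₁ p.1 * ν₂ p.2))
      (fun n => scale ℓ β n ^ (8 * (m : ℝ) * β + 8 * (m : ℝ) * γ))

/-- Asymptotic weak dependence. Points of `S n` are written `((x₁, z₁), (x₂, z₂))`. -/
def WeakDependence (P : Measure Ω) (ν₁ ν₂ : ℝ → ℝ) (β γ ℓ : ℝ)
    (K : ℝ → Ω → ℝ) (M : ℕ → ℝ → ℝ → Ω → ℝ) : Prop :=
  ∃ (S : ℕ → Set ((ℝ × ℝ) × (ℝ × ℝ)))
    (g₁ : MvPolynomial (Fin 4) ℝ) (g₂ : MvPolynomial (Fin 3) ℝ),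
    (∀ n : ℕ, 1 ≤ n → MeasurableSet (S n)) ∧
    Precsim
      (fun n => ∫⁻ p in (S n)ᶜ,
        ENNReal.ofReal (ν₁ p.1.1 * ν₂ p.1.2 * (ν₁ p.2.1 * ν₂ p.2.2)))
      (fun n => scale ℓ β n ^ (1 / 2 : ℝ)) ∧
    (∀ n : ℕ, 1 ≤ n → ∀ x₁ z₁ x₂ z₂ : ℝ, ((x₁, z₁), (x₂, z₂)) ∈ S n →
      |∫ ω, M n x₁ z₁ ω * M n x₂ z₂ ω ∂P| ≤
        MvPolynomial.eval ![x₁, z₁, x₂, z₂] g₁ * scale ℓ β n ^ (2 * β + γ)) ∧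
    (∀ n : ℕ, 1 ≤ n → ∀ x₁ z₁ x₂ : ℝ,
      |∫ ω, M n x₁ z₁ ω * K x₂ ω ∂P| ≤
        MvPolynomial.eval ![x₁, z₁, x₂] g₂ * scale ℓ β n ^ (β + γ))

/-- The anomalous scaling framework of assumptions. -/
structure AnomalousScalingFramework (P : Measure Ω) (ν₁ ν₂ : ℝ → ℝ) (β γ ℓ : ℝ) (m : ℕ)
    (K : ℝ → Ω → ℝ) (q M : ℕ → ℝ → ℝ → Ω → ℝ) (h : ℝ → ℝ → ℝ) : Prop where
  density₁ : IsDensityWithMoments ν₁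
  density₂ : IsDensityWithMoments ν₂
  beta_pos : 0 < β
  gamma_pos : 0 < γ
  ell_pos : 0 < ℓ
  m_large : 3 + 144 * β / min (24 * γ) 1 < (m : ℝ)
  proposal : IsProposalDensity P q
  perturbation : GaussianPerturbation P ν₁ m K
  proposal_asymptotics : ProposalAsymptotics P ν₁ ν₂ β γ ℓ m q
  approx_normality : ApproxNormality P ν₁ ν₂ β γ ℓ m K q M h
  weak_dependence : WeakDependence P ν₁ ν₂ β γ ℓ K M

end Environment

/-! ### Gaussian integration by parts -/

section GaussianIntegrationByParts

open scoped NNReal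

/-! Write μ for the product of the measures with densities ν₁ and ν₂, and X_n = M_n / σ_n^β, a
centred Gaussian field with variance h. After the substitution y = x + σ_n z, the rescaled second
moment is ∫ (X_n + Δ_n/σ_n^β)² L_n e^K dμ. Its distance from ∫ h e^K dμ splits into two errors: the
integral of `perturbationError`, due to replacing the integrand by X_n² e^K, and W_n = ∫ (X_n² − h)
e^K dμ, which is `avgExpCentredSq`. For each error some moment is O(n^{-s}) with s > 1. The expected
sum over n is then finite, so the error tends to zero almost surely
(`ae_tendsto_zero_of_integral_pow_le`). Nothing is needed about the dependence between different n.

The first error is small pointwise in mean: Δ_n/σ_n^β and L_n − 1 both have size ε = n^{-γ/(2β)},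
and an elementary inequality gives an m-th moment of order ε^m (`integral_perturbed_sq_pow_le`).

The second error is small only because of averaging over space. Gaussian integration by parts in one
factor X_s of W^{2r} (`integral_expCentredSq_mul_prod`, `integral_avg_pow_succ`) gives E W^{2r} =
E[R W^{2r−1}] + (2r−1) E[Q W^{2r−2}]. Here R carries only cov(X_s, K_s), and Q carries cov(X_s, X_t)
and cov(X_s, K_t); the large term Var X_s cancels because X_s² is centred. Weak dependence makes R
of order ε and Q of order ε + √δ, where δ is the mass of the exceptional pairs. Young's inequality
absorbs the powers of W into the left side (`integral_avg_pow_le`).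

All factors are dominated by one envelope, whose moments up to order m are bounded uniformly in n
thanks to E e^{2mK} = e^{2m²k}. The lower bound on m makes the resulting powers of n summable
(`one_lt_exponents`). -/

theorem hasDerivAt_gaussianPDFReal {v : ℝ≥0} (hv : v ≠ 0) (t : ℝ) :
    HasDerivAt (gaussianPDFReal 0 v) (-(t / v) * gaussianPDFReal 0 v t) t := by
  have hv' : (v : ℝ) ≠ 0 := by exact_mod_cast hv
  have h₁ : HasDerivAt (fun t : ℝ => -(t - 0) ^ 2 / (2 * v)) (-(t / v)) t := by
    have := ((((hasDerivAt_id t).sub_const 0).pow 2).neg).div_const (2 * (v : ℝ))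
    refine this.congr_deriv ?_
    simp only [id, sub_zero]
    field_simp
    norm_num
  have := (h₁.exp).const_mul (√(2 * Real.pi * v))⁻¹
  rw [gaussianPDFReal_def]
  refine this.congr_deriv ?_
  ring

theorem integrable_gaussianReal_iff {v : ℝ≥0} (hv : v ≠ 0) {f : ℝ → ℝ} :
    Integrable f (gaussianReal 0 v) ↔ Integrable (fun t => gaussianPDFReal 0 v t * f t) := by
  rw [gaussianReal_of_var_ne_zero _ hv,
    integrable_withDensity_iff_integrable_smul' (measurable_gaussianPDF _ _)
      (ae_of_all _ fun _ => gaussianPDF_lt_top)]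
  simp

/-- Stein's identity for a centred Gaussian variable. -/
theorem integral_id_mul_gaussianReal {v : ℝ≥0} (hv : v ≠ 0) {g g' : ℝ → ℝ}
    (hd : ∀ t, HasDerivAt g (g' t) t)
    (h₁ : Integrable (fun t => t * g t) (gaussianReal 0 v))
    (h₂ : Integrable g (gaussianReal 0 v)) (h₃ : Integrable g' (gaussianReal 0 v)) :
    ∫ t, t * g t ∂gaussianReal 0 v = v * ∫ t, g' t ∂gaussianReal 0 v := by
  have hv' : (v : ℝ) ≠ 0 := by exact_mod_cast hv
  rw [integrable_gaussianReal_iff hv] at h₁ h₂ h₃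
  simp only [integral_gaussianReal_eq_integral_smul hv, smul_eq_mul]
  -- Integrability on the whole line of the product and of the two derivative terms makes the
  -- boundary terms vanish.
  have key := integral_mul_deriv_eq_deriv_mul_of_integrable (u := g) (u' := g')
    (v := gaussianPDFReal 0 v) (v' := fun t => -(t / v) * gaussianPDFReal 0 v t)
    (fun t _ => hd t) (fun t _ => hasDerivAt_gaussianPDFReal hv t)
    (by
      refine (h₁.const_mul (-(v : ℝ)⁻¹)).congr (ae_of_all _ fun t => ?_)
      simp only [Pi.mul_apply]
      ring)
    (by
      refine h₃.congr (ae_of_all _ fun t => ?_)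
      simp only [Pi.mul_apply]
      ring)
    (by
      refine h₂.congr (ae_of_all _ fun t => ?_)
      simp only [Pi.mul_apply]
      ring)
  calc ∫ t, gaussianPDFReal 0 v t * (t * g t)
      = ∫ t, -(v : ℝ) * (g t * (-(t / v) * gaussianPDFReal 0 v t)) := by
        congr 1 with t
        field_simp
    _ = v * ∫ t, gaussianPDFReal 0 v t * g' t := by
        rw [integral_const_mul, key]
        simp only [mul_neg, neg_mul, neg_neg]
        congr 2 with t
        ring

variable {Ω : Type*} [MeasurableSpace Ω] {P : Measure Ω}

/-- Stein's identity with an independent parameter. -/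
theorem integral_mul_eq_of_indepFun [IsProbabilityMeasure P] {E : Type*} [MeasurableSpace E]
    {v : ℝ≥0} (hv : v ≠ 0)
    {X : Ω → ℝ} {Z : Ω → E} (hX : P.map X = gaussianReal 0 v) (hXm : AEMeasurable X P)
    (hZm : AEMeasurable Z P) (hind : IndepFun X Z P) {g g' : ℝ × E → ℝ}
    (hg : Measurable g) (hg' : Measurable g')
    (hd : ∀ z t, HasDerivAt (fun t => g (t, z)) (g' (t, z)) t)
    (h₁ : Integrable (fun ω => X ω * g (X ω, Z ω)) P)
    (h₂ : Integrable (fun ω => g (X ω, Z ω)) P)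
    (h₃ : Integrable (fun ω => g' (X ω, Z ω)) P) :
    ∫ ω, X ω * g (X ω, Z ω) ∂P = v * ∫ ω, g' (X ω, Z ω) ∂P := by
  have hXZ : AEMeasurable (fun ω => (X ω, Z ω)) P := hXm.prodMk hZm
  have hmap : P.map (fun ω => (X ω, Z ω)) = (gaussianReal 0 v).prod (P.map Z) := by
    rw [← hX]
    exact (indepFun_iff_map_prod_eq_prod_map_map hXm hZm).1 hind
  have : IsProbabilityMeasure (P.map Z) := Measure.isProbabilityMeasure_map hZm
  have hG : Measurable fun p : ℝ × E => p.1 * g p := measurable_fst.mul hg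
  have i₁ : Integrable (fun p : ℝ × E => p.1 * g p) ((gaussianReal 0 v).prod (P.map Z)) := by
    rw [← hmap, integrable_map_measure hG.aestronglyMeasurable hXZ]
    exact h₁
  have i₂ : Integrable g ((gaussianReal 0 v).prod (P.map Z)) := by
    rw [← hmap, integrable_map_measure hg.aestronglyMeasurable hXZ]
    exact h₂
  have i₃ : Integrable g' ((gaussianReal 0 v).prod (P.map Z)) := by
    rw [← hmap, integrable_map_measure hg'.aestronglyMeasurable hXZ]
    exact h₃
  have e₁ : ∫ ω, X ω * g (X ω, Z ω) ∂P
      = ∫ p : ℝ × E, p.1 * g p ∂((gaussianReal 0 v).prod (P.map Z)) := by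
    rw [← hmap, integral_map hXZ hG.aestronglyMeasurable]
  have e₂ : ∫ ω, g' (X ω, Z ω) ∂P = ∫ p, g' p ∂((gaussianReal 0 v).prod (P.map Z)) := by
    rw [← hmap, integral_map hXZ hg'.aestronglyMeasurable]
  rw [e₁, e₂, integral_prod_symm _ i₁, integral_prod_symm _ i₃, ← integral_const_mul]
  refine integral_congr_ae ?_
  -- By Fubini almost every section in the parameter is integrable, and there the one-dimensional
  -- identity applies.
  filter_upwards [i₁.prod_left_ae, i₂.prod_left_ae, i₃.prod_left_ae] with z a₁ a₂ a₃
  exact integral_id_mul_gaussianReal hv (hd z) a₁ a₂ a₃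

/-- The residuals of a linear regression on `X` are independent of `X` in a Gaussian process. -/
theorem ProbabilityTheory.IsGaussianProcess.indepFun_residual {J : Type*} {X : Ω → ℝ}
    {Y : J → Ω → ℝ} (hG : IsGaussianProcess (Sum.elim (fun _ : Unit => X) Y) P)
    (hv : Var[X; P] ≠ 0) :
    IndepFun X (fun ω j => Y j ω - cov[X, Y j; P] / Var[X; P] * X ω) P := by
  have := hG.isProbabilityMeasure
  have gX : HasGaussianLaw X P := hG.hasGaussianLaw_eval (.inl ())
  have gY : ∀ j, HasGaussianLaw (Y j) P := fun j => hG.hasGaussianLaw_eval (.inr j)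
  have key : IsGaussianProcess (Sum.elim (fun _ : Unit => X)
      (fun j ω => Y j ω - cov[X, Y j; P] / Var[X; P] * X ω)) P := by
    classical
    refine hG.of_isGaussianProcess fun s => ?_
    rcases s with s | j
    · exact ⟨{.inl ()}, .proj ⟨.inl (), by simp⟩, fun ω => rfl⟩
    · exact ⟨{.inl (), .inr j}, .proj ⟨.inr j, by simp⟩ -
        (cov[X, Y j; P] / Var[X; P]) • .proj ⟨.inl (), by simp⟩, fun ω => rfl⟩
  have hind := key.indepFun_of_covariance_eq_zero (fun _ => gX.aemeasurable)
    (fun j => (gY j).aemeasurable.sub (gX.aemeasurable.const_mul _)) (fun _ j => by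
      change cov[X, Y j - fun ω => cov[X, Y j; P] / Var[X; P] * X ω; P] = 0
      rw [covariance_sub_right gX.memLp_two (gY j).memLp_two (gX.memLp_two.const_mul _),
        covariance_const_mul_right, covariance_self gX.aemeasurable]
      field_simp
      ring)
  exact hind.comp (φ := fun f : Unit → ℝ => f ()) (ψ := id) (measurable_pi_apply _) measurable_id

/-- All moments of `f` are finite. -/
def HasAllMoments (f : Ω → ℝ) (P : Measure Ω) : Prop := ∀ q : ℝ≥0, MemLp f q P

namespace HasAllMoments

variable {f g : Ω → ℝ}

theorem const [IsFiniteMeasure P] (c : ℝ) : HasAllMoments (fun _ : Ω => c) P :=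
  fun _ => memLp_const c

theorem add (hf : HasAllMoments f P) (hg : HasAllMoments g P) :
    HasAllMoments (fun ω => f ω + g ω) P := fun q => (hf q).add (hg q)

/-- Hölder with exponents 2q and 2q. Closure under products is the reason to ask for all moments:
integrability of every product of polynomials and exponentials of Gaussian variables becomes
automatic. -/
theorem mul (hf : HasAllMoments f P) (hg : HasAllMoments g P) :
    HasAllMoments (fun ω => f ω * g ω) P := by
  intro q
  have : ENNReal.HolderTriple ((2 * q : ℝ≥0) : ℝ≥0∞) ((2 * q : ℝ≥0) : ℝ≥0∞) q := by
    constructor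
    push_cast
    rw [ENNReal.mul_inv (by simp) (by simp), ← add_mul, ENNReal.inv_two_add_inv_two, one_mul]
  exact (hg (2 * q)).mul (hf (2 * q))

theorem integrable (hf : HasAllMoments f P) : Integrable f P :=
  memLp_one_iff_integrable.1 (by simpa using hf 1)

theorem prod [IsFiniteMeasure P] {ι : Type*} {f : ι → Ω → ℝ} (s : Finset ι)
    (hf : ∀ i ∈ s, HasAllMoments (f i) P) : HasAllMoments (fun ω => ∏ i ∈ s, f i ω) P := by
  classical
  induction s using Finset.induction_on with
  | empty => simpa using const 1
  | insert a s ha ih =>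
    simp only [Finset.prod_insert ha]
    exact (hf a (by simp)).mul (ih fun i hi => hf i (by simp [hi]))

theorem eval [IsFiniteMeasure P] (hf : HasAllMoments f P) (p : Polynomial ℝ) :
    HasAllMoments (fun ω => p.eval (f ω)) P := by
  induction p using Polynomial.induction_on with
  | C a => simpa using const a
  | add p q hp hq => simpa using hp.add hq
  | monomial n a h => simpa [pow_succ, mul_assoc] using h.mul hf

end HasAllMoments

theorem ProbabilityTheory.HasGaussianLaw.hasAllMoments {X : Ω → ℝ} (hX : HasGaussianLaw X P) :
    HasAllMoments X P := fun _ => hX.memLp (by simp)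

theorem ProbabilityTheory.HasGaussianLaw.integrable_exp_mul {X : Ω → ℝ} (hX : HasGaussianLaw X P)
    (t : ℝ) : Integrable (fun ω => Real.exp (t * X ω)) P := by
  have h := integrable_exp_mul_gaussianReal (μ := P[X]) (v := Var[X; P].toNNReal) t
  rw [← hX.map_eq_gaussianReal,
    integrable_map_measure (by fun_prop) hX.aemeasurable] at h
  exact h

theorem ProbabilityTheory.HasGaussianLaw.hasAllMoments_exp {X : Ω → ℝ}
    (hX : HasGaussianLaw X P) : HasAllMoments (fun ω => Real.exp (X ω)) P := by
  have := hX.isProbabilityMeasure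
  intro q
  rcases eq_or_ne q 0 with rfl | hq
  · simpa using hX.aemeasurable.exp.aestronglyMeasurable
  rw [← integrable_norm_rpow_iff (by have := hX.aemeasurable; fun_prop) (by simpa using hq)
    (by simp)]
  refine (hX.integrable_exp_mul q).congr (ae_of_all _ fun ω => ?_)
  simp only [Real.norm_eq_abs, Real.abs_exp, ENNReal.coe_toReal]
  rw [← Real.exp_mul, mul_comm]

variable {ι : Type*} [Fintype ι]

theorem hasAllMoments_prod_eval_mul_exp [IsProbabilityMeasure P] {U W : ι → Ω → ℝ}
    (hU : ∀ i, HasGaussianLaw (U i) P) (hW : ∀ i, HasGaussianLaw (W i) P)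
    (p : ι → Polynomial ℝ) :
    HasAllMoments (fun ω => ∏ i, (p i).eval (U i ω) * Real.exp (W i ω)) P :=
  HasAllMoments.prod _ fun i _ => ((hU i).hasAllMoments.eval (p i)).mul (hW i).hasAllMoments_exp

/-- Gaussian integration by parts for a product of polynomials times exponentials. -/
theorem ProbabilityTheory.IsGaussianProcess.integral_mul_prod [DecidableEq ι] {X : Ω → ℝ}
    {U W : ι → Ω → ℝ}
    (hG : IsGaussianProcess (Sum.elim (fun _ : Unit => X) (Sum.elim U W)) P)
    (h₀ : ∫ ω, X ω ∂P = 0) (p : ι → Polynomial ℝ) :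
    ∫ ω, X ω * ∏ i, (p i).eval (U i ω) * Real.exp (W i ω) ∂P =
      ∑ i, ∫ ω, ∏ l, (Function.update p i (.C cov[X, U i; P] * (p i).derivative +
        .C cov[X, W i; P] * p i) l).eval (U l ω) * Real.exp (W l ω) ∂P := by
  have := hG.isProbabilityMeasure
  have gX : HasGaussianLaw X P := hG.hasGaussianLaw_eval (.inl ())
  have gU : ∀ i, HasGaussianLaw (U i) P := fun i => hG.hasGaussianLaw_eval (.inr (.inl i))
  have gW : ∀ i, HasGaussianLaw (W i) P := fun i => hG.hasGaussianLaw_eval (.inr (.inr i))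
  rcases eq_or_ne Var[X; P] 0 with hv | hv
  -- Degenerate case: X vanishes almost surely, so all its covariances are zero and the updated
  -- polynomial in each summand is the zero polynomial.
  · have hX : X =ᵐ[P] 0 := by
      have := ae_eq_integral_of_variance_eq_zero gX.memLp_two hv
      filter_upwards [this] with ω hω
      simpa [h₀] using hω
    have hc : ∀ Y : Ω → ℝ, cov[X, Y; P] = 0 := fun Y => by
      rw [covariance, integral_eq_zero_of_ae]
      filter_upwards [hX] with ω hω
      simp [hω, h₀]
    rw [integral_eq_zero_of_ae (by filter_upwards [hX] with ω hω; simp [hω]), eq_comm]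
    refine Finset.sum_eq_zero fun i _ => integral_eq_zero_of_ae (ae_of_all _ fun ω => ?_)
    refine Finset.prod_eq_zero (Finset.mem_univ i) ?_
    simp [hc]
  set v : ℝ≥0 := Var[X; P].toNNReal with hvdef
  have hvv : (v : ℝ) = Var[X; P] := Real.coe_toNNReal _ (variance_nonneg _ _)
  have hv0 : v ≠ 0 := fun h => hv (by rw [← hvv, h]; rfl)
  have hmap : P.map X = gaussianReal 0 v := by rw [gX.map_eq_gaussianReal, h₀]
  -- Regression coefficients on X. With Z the family of residuals, independent of X, one has U_i =
  -- Z_i + d_i X, and likewise for W_i with e_i. For fixed Z the product is a smooth function of X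
  -- alone, and its derivative carries the factors d_i, e_i; multiplying by Var X turns them back
  -- into covariances.
  set d : ι → ℝ := fun i => cov[X, U i; P] / Var[X; P] with hd
  set e : ι → ℝ := fun i => cov[X, W i; P] / Var[X; P] with he
  set Y : ι ⊕ ι → Ω → ℝ := Sum.elim U W
  set Z : Ω → (ι ⊕ ι → ℝ) := fun ω j => Y j ω - cov[X, Y j; P] / Var[X; P] * X ω with hZ
  have hZm : AEMeasurable Z P := by
    refine aemeasurable_pi_lambda _ fun j => ?_
    exact (hG.hasGaussianLaw_eval (.inr j)).aemeasurable.sub (gX.aemeasurable.const_mul _)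
  let u : ι → ℝ × (ι ⊕ ι → ℝ) → ℝ := fun i y => y.2 (.inl i) + d i * y.1
  let w : ι → ℝ × (ι ⊕ ι → ℝ) → ℝ := fun i y => y.2 (.inr i) + e i * y.1
  have hu : ∀ i ω, u i (X ω, Z ω) = U i ω := fun i ω => by simp [u, hZ, hd, Y]
  have hw : ∀ i ω, w i (X ω, Z ω) = W i ω := fun i ω => by simp [w, hZ, he, Y]
  let F : (ι → Polynomial ℝ) → ℝ × (ι ⊕ ι → ℝ) → ℝ :=
    fun p y => ∏ i, (p i).eval (u i y) * Real.exp (w i y)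
  let p' : ι → ι → Polynomial ℝ := fun i =>
    Function.update p i (.C (d i) * (p i).derivative + .C (e i) * p i)
  have hum : ∀ i, Measurable (u i) := fun i => by fun_prop
  have hwm : ∀ i, Measurable (w i) := fun i => by fun_prop
  have hFm : ∀ p, Measurable (F p) := fun p =>
    Finset.measurable_prod _ fun i _ =>
      ((p i).continuous.measurable.comp (hum i)).mul (Real.measurable_exp.comp (hwm i))
  have hF : ∀ p ω, F p (X ω, Z ω) = ∏ i, (p i).eval (U i ω) * Real.exp (W i ω) :=
    fun p ω => by simp only [F, hu, hw]
  have hFi : ∀ p, HasAllMoments (fun ω => F p (X ω, Z ω)) P := fun p => by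
    simp only [hF]
    exact hasAllMoments_prod_eval_mul_exp gU gW p
  have hderiv : ∀ z t, HasDerivAt (fun t => F p (t, z)) (∑ i, F (p' i) (t, z)) t := by
    intro z t
    have h1 : ∀ i ∈ Finset.univ, HasDerivAt
        (fun t => (p i).eval (u i (t, z)) * Real.exp (w i (t, z)))
        ((p' i i).eval (u i (t, z)) * Real.exp (w i (t, z))) t := by
      intro i _
      have a₁ : HasDerivAt (fun t => u i (t, z)) (d i) t := by
        simpa [u] using ((hasDerivAt_id t).const_mul (d i)).const_add (z (.inl i))
      have a₂ : HasDerivAt (fun t => w i (t, z)) (e i) t := by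
        simpa [w] using ((hasDerivAt_id t).const_mul (e i)).const_add (z (.inr i))
      have a₃ := (((p i).hasDerivAt (u i (t, z))).comp t a₁).mul a₂.exp
      refine a₃.congr_deriv ?_
      simp only [p', Function.update_self, Polynomial.eval_add, Polynomial.eval_mul,
        Polynomial.eval_C, Function.comp_apply]
      ring
    refine (HasDerivAt.fun_finsetProd h1).congr_deriv ?_
    refine Finset.sum_congr rfl fun i _ => ?_
    simp only [F, smul_eq_mul]
    rw [← Finset.prod_erase_mul _ _ (Finset.mem_univ i)]
    congr 1
    refine Finset.prod_congr rfl fun l hl => ?_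
    simp [p', Finset.ne_of_mem_erase hl]
  have key := integral_mul_eq_of_indepFun hv0 hmap gX.aemeasurable hZm (hG.indepFun_residual hv)
    (hFm p) (Finset.measurable_sum _ fun i _ => hFm (p' i)) hderiv
    (gX.hasAllMoments.mul (hFi p)).integrable (hFi p).integrable
    (integrable_finsetSum _ fun i _ => (hFi (p' i)).integrable)
  rw [integral_finsetSum _ fun i _ => (hFi (p' i)).integrable, Finset.mul_sum] at key
  simp only [hF] at key
  rw [key]
  refine Finset.sum_congr rfl fun i _ => ?_
  rw [← integral_const_mul]
  congr 1 with ω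
  rw [← Finset.mul_prod_erase _ _ (Finset.mem_univ i), ← mul_assoc,
    ← Finset.mul_prod_erase _ _ (Finset.mem_univ i)]
  congr 1
  · simp only [p', Function.update_self, hvv, hd, he, Polynomial.eval_add, Polynomial.eval_mul,
      Polynomial.eval_C]
    field_simp
  · refine Finset.prod_congr rfl fun l hl => ?_
    simp [p', Finset.ne_of_mem_erase hl]

end GaussianIntegrationByParts

/-! ### Integration by parts for centred squares weighted by exponentials -/

section GaussianField

variable {Ω T : Type*} [MeasurableSpace Ω] [MeasurableSpace T] {P : Measure Ω} {μ : Measure T}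
  {X K : T → Ω → ℝ} {w : T → ℝ}

/-- A jointly Gaussian pair of measurable fields `X`, `K`, with `X` centred, whose covariances are
controlled by a weight `w ≥ 1`. -/
structure WeightedGaussianField (P : Measure Ω) (X K : T → Ω → ℝ) (w : T → ℝ) : Prop where
  measurable_left : Measurable (fun p : Ω × T => X p.2 p.1)
  measurable_right : Measurable (fun p : Ω × T => K p.2 p.1)
  gaussian : IsGaussianProcess (Sum.elim X K) P
  centred : ∀ t, ∫ ω, X t ω ∂P = 0
  measurable_weight : Measurable w
  one_le_weight : ∀ t, 1 ≤ w t
  abs_covariance_left_le : ∀ s t, |cov[X s, X t; P]| ≤ w s * w t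
  abs_covariance_right_le : ∀ s t, |cov[X s, K t; P]| ≤ w s * w t

/-- The centred square of `X t`, weighted by `exp (K t)`. -/
noncomputable def expCentredSq (P : Measure Ω) (X K : T → Ω → ℝ) (t : T) (ω : Ω) : ℝ :=
  (X t ω ^ 2 - Var[X t; P]) * Real.exp (K t ω)

/-- The directional derivative of `expCentredSq` along the covariances with `X s`. -/
noncomputable def expCentredSqDeriv (P : Measure Ω) (X K : T → Ω → ℝ) (s t : T) (ω : Ω) : ℝ :=
  (2 * cov[X s, X t; P] * X t ω + cov[X s, K t; P] * (X t ω ^ 2 - Var[X t; P])) *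
    Real.exp (K t ω)

/-- A common bound for the factors occurring in the integration by parts. -/
noncomputable def fieldEnvelope (X K : T → Ω → ℝ) (w : T → ℝ) (t : T) (ω : Ω) : ℝ :=
  w t * (1 + X t ω ^ 2 + w t ^ 2) * Real.exp (K t ω)

namespace WeightedGaussianField

theorem isProbabilityMeasure (hF : WeightedGaussianField P X K w) : IsProbabilityMeasure P :=
  hF.gaussian.isProbabilityMeasure

theorem gaussian_left (hF : WeightedGaussianField P X K w) (t : T) : HasGaussianLaw (X t) P :=
  hF.gaussian.hasGaussianLaw_eval (.inl t)

theorem gaussian_right (hF : WeightedGaussianField P X K w) (t : T) : HasGaussianLaw (K t) P :=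
  hF.gaussian.hasGaussianLaw_eval (.inr t)

theorem covariance_left_eq (hF : WeightedGaussianField P X K w) {Y : Ω → ℝ}
    (hY : HasGaussianLaw Y P) (s : T) :
    cov[X s, Y; P] = ∫ ω, X s ω * Y ω ∂P := by
  have := hF.isProbabilityMeasure
  rw [covariance_eq_sub (hF.gaussian_left s).memLp_two hY.memLp_two, hF.centred s]
  simp

/-- Since X is centred the covariance is the plain integral of a product, and a parametric integral
of a jointly measurable function is measurable. -/
theorem measurable_covariance_left (hF : WeightedGaussianField P X K w) :
    Measurable fun p : T × T => cov[X p.1, X p.2; P] := by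
  have := hF.isProbabilityMeasure
  have h : StronglyMeasurable fun p : (T × T) × Ω => X p.1.1 p.2 * X p.1.2 p.2 :=
    ((hF.measurable_left.comp (measurable_snd.prodMk (measurable_fst.comp measurable_fst))).mul
      (hF.measurable_left.comp
        (measurable_snd.prodMk (measurable_snd.comp measurable_fst)))).stronglyMeasurable
  simp only [fun p : T × T => hF.covariance_left_eq (hF.gaussian_left p.2) p.1]
  exact (h.integral_prod_right' (ν := P)).measurable

theorem measurable_covariance_right (hF : WeightedGaussianField P X K w) :
    Measurable fun p : T × T => cov[X p.1, K p.2; P] := by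
  have := hF.isProbabilityMeasure
  have h : StronglyMeasurable fun p : (T × T) × Ω => X p.1.1 p.2 * K p.1.2 p.2 :=
    ((hF.measurable_left.comp (measurable_snd.prodMk (measurable_fst.comp measurable_fst))).mul
      (hF.measurable_right.comp
        (measurable_snd.prodMk (measurable_snd.comp measurable_fst)))).stronglyMeasurable
  simp only [fun p : T × T => hF.covariance_left_eq (hF.gaussian_right p.2) p.1]
  exact (h.integral_prod_right' (ν := P)).measurable

theorem variance_eq (hF : WeightedGaussianField P X K w) (t : T) :
    Var[X t; P] = cov[X t, X t; P] :=
  (covariance_self (hF.gaussian_left t).aemeasurable).symm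

theorem measurable_variance (hF : WeightedGaussianField P X K w) :
    Measurable fun t : T => Var[X t; P] := by
  simp only [hF.variance_eq]
  exact hF.measurable_covariance_left.comp (measurable_id.prodMk measurable_id)

theorem variance_le (hF : WeightedGaussianField P X K w) (t : T) : Var[X t; P] ≤ w t ^ 2 := by
  rw [hF.variance_eq, sq]
  exact (le_abs_self _).trans (hF.abs_covariance_left_le t t)

theorem measurable_expCentredSq (hF : WeightedGaussianField P X K w) :
    Measurable fun p : Ω × T => expCentredSq P X K p.2 p.1 := by
  have h₁ := hF.measurable_left
  have h₂ := hF.measurable_right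
  have h₃ : Measurable fun p : Ω × T => Var[X p.2; P] :=
    hF.measurable_variance.comp measurable_snd
  exact ((h₁.pow_const 2).sub h₃).mul h₂.exp

theorem measurable_fieldEnvelope (hF : WeightedGaussianField P X K w) :
    Measurable fun p : Ω × T => fieldEnvelope X K w p.2 p.1 := by
  have h₁ := hF.measurable_left
  have h₂ := hF.measurable_right
  have h₃ : Measurable fun p : Ω × T => w p.2 := hF.measurable_weight.comp measurable_snd
  exact (h₃.mul (((h₁.pow_const 2).const_add 1).add (h₃.pow_const 2))).mul h₂.exp

theorem measurable_expCentredSqDeriv (hF : WeightedGaussianField P X K w) :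
    Measurable fun p : Ω × T × T => expCentredSqDeriv P X K p.2.1 p.2.2 p.1 := by
  have m : Measurable fun p : Ω × T × T => (p.1, p.2.2) := by fun_prop
  have h₁ := hF.measurable_left.comp m
  have h₂ := hF.measurable_right.comp m
  have h₃ := hF.measurable_variance.comp (measurable_snd.comp m)
  have h₄ : Measurable fun p : Ω × T × T => cov[X p.2.1, X p.2.2; P] :=
    hF.measurable_covariance_left.comp measurable_snd
  have h₅ : Measurable fun p : Ω × T × T => cov[X p.2.1, K p.2.2; P] :=
    hF.measurable_covariance_right.comp measurable_snd
  exact (((h₄.const_mul 2).mul h₁).add (h₅.mul ((h₁.pow_const 2).sub h₃))).mul h₂.exp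

theorem fieldEnvelope_nonneg (hF : WeightedGaussianField P X K w) (t : T) (ω : Ω) :
    0 ≤ fieldEnvelope X K w t ω := by
  have := hF.one_le_weight t
  unfold fieldEnvelope
  positivity

theorem weight_mul_abs_mul_exp_le (hF : WeightedGaussianField P X K w) (t : T) (ω : Ω) :
    w t * |X t ω| * Real.exp (K t ω) ≤ fieldEnvelope X K w t ω := by
  have := hF.one_le_weight t
  unfold fieldEnvelope
  gcongr
  nlinarith [sq_nonneg (|X t ω| - 1), sq_abs (X t ω), sq_nonneg (w t), abs_nonneg (X t ω)]

theorem weight_sq_mul_abs_mul_exp_le (hF : WeightedGaussianField P X K w) (t : T) (ω : Ω) :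
    w t * w t * |X t ω| * Real.exp (K t ω) ≤ fieldEnvelope X K w t ω := by
  have := hF.one_le_weight t
  unfold fieldEnvelope
  rw [mul_assoc (w t) (w t)]
  gcongr
  nlinarith [sq_nonneg (|X t ω| - w t), sq_abs (X t ω), sq_nonneg (w t), abs_nonneg (X t ω)]

theorem abs_sq_sub_variance_le (hF : WeightedGaussianField P X K w) (t : T) (ω : Ω) :
    |X t ω ^ 2 - Var[X t; P]| ≤ X t ω ^ 2 + w t ^ 2 := by
  have h₁ := hF.variance_le t
  have h₂ := variance_nonneg (X t) P
  rw [abs_le]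
  constructor <;> nlinarith [sq_nonneg (X t ω)]

theorem abs_expCentredSq_le (hF : WeightedGaussianField P X K w) (t : T) (ω : Ω) :
    |expCentredSq P X K t ω| ≤ fieldEnvelope X K w t ω := by
  have h₁ := hF.one_le_weight t
  have h₂ := hF.abs_sq_sub_variance_le t ω
  unfold expCentredSq fieldEnvelope
  rw [abs_mul, Real.abs_exp]
  gcongr
  nlinarith [sq_nonneg (X t ω), sq_nonneg (w t)]

/-- Two rates are kept because the two covariances are small on different sets: the one with K for
all pairs, the one between values of X only for good pairs. Good pairs use a = ε, the others a = 1,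
both with b = ε. -/
theorem abs_expCentredSqDeriv_le (hF : WeightedGaussianField P X K w) {a b : ℝ} {s t : T}
    (ha : |cov[X s, X t; P]| ≤ a * (w s * w t)) (hb : |cov[X s, K t; P]| ≤ b * (w s * w t))
    (hba : b ≤ a) (hb₀ : 0 ≤ b) (ω : Ω) :
    |expCentredSqDeriv P X K s t ω| ≤ w s * (2 * a * fieldEnvelope X K w t ω) := by
  have h₁ := hF.one_le_weight t
  have h₁' := hF.one_le_weight s
  have h₂ := hF.abs_sq_sub_variance_le t ω
  have h₃ : 2 * |X t ω| ≤ 1 + X t ω ^ 2 := by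
    nlinarith [sq_nonneg (|X t ω| - 1), sq_abs (X t ω)]
  have ha₀ : 0 ≤ a := hb₀.trans hba
  unfold expCentredSqDeriv fieldEnvelope
  rw [abs_mul, Real.abs_exp]
  calc |2 * cov[X s, X t; P] * X t ω + cov[X s, K t; P] * (X t ω ^ 2 - Var[X t; P])| *
        Real.exp (K t ω)
      ≤ (a * (w s * w t) * (2 * |X t ω|) + a * (w s * w t) * (X t ω ^ 2 + w t ^ 2)) *
          Real.exp (K t ω) := by
        gcongr
        refine (abs_add_le _ _).trans ?_
        rw [abs_mul, abs_mul, abs_mul, abs_two]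
        have hb' : |cov[X s, K t; P]| ≤ a * (w s * w t) := hb.trans (by gcongr)
        have e : 2 * |cov[X s, X t; P]| * |X t ω| = |cov[X s, X t; P]| * (2 * |X t ω|) := by ring
        rw [e]
        gcongr
    _ ≤ (a * (w s * w t) * (1 + X t ω ^ 2 + w t ^ 2) +
          a * (w s * w t) * (1 + X t ω ^ 2 + w t ^ 2)) * Real.exp (K t ω) := by
        gcongr ?_ * _
        gcongr
        · nlinarith [sq_nonneg (w t)]
        · linarith
    _ = w s * (2 * a * (w t * (1 + X t ω ^ 2 + w t ^ 2) * Real.exp (K t ω))) := by ring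

/-- Integrate by parts in one factor X_s of X_s² e^{K_s}. Differentiating the other factor X_s
produces Var X_s times e^{K_s}, exactly what the centring subtracts, so only covariances with K_s
and with the other points survive. -/
theorem integral_expCentredSq_mul_prod (hF : WeightedGaussianField P X K w) {k : ℕ} (s : T)
    (t : Fin k → T) :
    ∫ ω, expCentredSq P X K s ω * ∏ l, expCentredSq P X K (t l) ω ∂P =
      (∫ ω, cov[X s, K s; P] * (X s ω * Real.exp (K s ω)) *
        ∏ l, expCentredSq P X K (t l) ω ∂P) +
      ∑ j, ∫ ω, X s ω * Real.exp (K s ω) *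
        ∏ l, (if l = j then expCentredSqDeriv P X K s (t l) ω
          else expCentredSq P X K (t l) ω) ∂P := by
  classical
  have := hF.isProbabilityMeasure
  -- The index `none` stands for the point s, with polynomial X because one factor of X_s² has been
  -- taken out; `some l` stands for t_l, with the full centred square.
  let τ : Option (Fin k) → T := fun o => o.elim s t
  let p : Option (Fin k) → Polynomial ℝ :=
    fun o => o.elim .X (fun j => .X ^ 2 - .C Var[X (t j); P])
  have hG : IsGaussianProcess (Sum.elim (fun _ : Unit => X s)
      (Sum.elim (fun o => X (τ o)) (fun o => K (τ o)))) P := by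
    have e : Sum.elim (fun _ : Unit => X s) (Sum.elim (fun o => X (τ o)) (fun o => K (τ o))) =
        Sum.elim X K ∘ Sum.elim (fun _ : Unit => Sum.inl s) (Sum.map τ τ) := by
      funext i
      rcases i with i | i | i <;> rfl
    rw [e]
    exact hF.gaussian.comp_right _
  have key := hG.integral_mul_prod (hF.centred s) p
  simp only [Fintype.sum_option, Fintype.prod_option] at key
  have hall : ∀ p : Fin k → Polynomial ℝ, HasAllMoments
      (fun ω => ∏ l, (p l).eval (X (t l) ω) * Real.exp (K (t l) ω)) P := fun p =>
    hasAllMoments_prod_eval_mul_exp (fun l => hF.gaussian_left (t l))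
      (fun l => hF.gaussian_right (t l)) p
  have hφ : ∀ l ω, (p (some l)).eval (X (t l) ω) * Real.exp (K (t l) ω)
      = expCentredSq P X K (t l) ω := fun l ω => by
    simp [p, expCentredSq]
  have hφall : HasAllMoments (fun ω => ∏ l, expCentredSq P X K (t l) ω) P := by
    simpa only [hφ] using hall (fun l => p (some l))
  have hXs := (hF.gaussian_left s).hasAllMoments
  have hKs := (hF.gaussian_right s).hasAllMoments_exp
  have e₁ : ∀ ω, X s ω * ((p none).eval (X (τ none) ω) * Real.exp (K (τ none) ω) *
      ∏ l, (p (some l)).eval (X (τ (some l)) ω) * Real.exp (K (τ (some l)) ω)) =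
      expCentredSq P X K s ω * ∏ l, expCentredSq P X K (t l) ω +
        Var[X s; P] * (Real.exp (K s ω) * ∏ l, expCentredSq P X K (t l) ω) := fun ω => by
    simp only [τ, Option.elim, hφ]
    simp only [p, Option.elim, Polynomial.eval_X, expCentredSq]
    ring
  have e₂ : ∀ ω, (Function.update p none (.C cov[X s, X (τ none); P] * (p none).derivative +
        .C cov[X s, K (τ none); P] * p none) none).eval (X (τ none) ω) * Real.exp (K (τ none) ω) *
      ∏ l, (Function.update p none (.C cov[X s, X (τ none); P] * (p none).derivative +
        .C cov[X s, K (τ none); P] * p none) (some l)).eval (X (τ (some l)) ω) *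
          Real.exp (K (τ (some l)) ω) =
      cov[X s, K s; P] * (X s ω * Real.exp (K s ω)) * ∏ l, expCentredSq P X K (t l) ω +
        Var[X s; P] * (Real.exp (K s ω) * ∏ l, expCentredSq P X K (t l) ω) := fun ω => by
    simp only [Function.update_self, Function.update_of_ne (Option.some_ne_none _), τ, Option.elim,
      hφ, hF.variance_eq]
    simp [p]
    ring
  have e₃ : ∀ j ω, (Function.update p (some j)
        (.C cov[X s, X (τ (some j)); P] * (p (some j)).derivative +
        .C cov[X s, K (τ (some j)); P] * p (some j)) none).eval (X (τ none) ω) *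
          Real.exp (K (τ none) ω) *
      ∏ l, (Function.update p (some j)
        (.C cov[X s, X (τ (some j)); P] * (p (some j)).derivative +
        .C cov[X s, K (τ (some j)); P] * p (some j)) (some l)).eval (X (τ (some l)) ω) *
          Real.exp (K (τ (some l)) ω) =
      X s ω * Real.exp (K s ω) *
        ∏ l, (if l = j then expCentredSqDeriv P X K s (t l) ω
          else expCentredSq P X K (t l) ω) := fun j ω => by
    rw [Function.update_of_ne (Option.some_ne_none _).symm]
    congr 1
    · simp [p, τ]
    refine Finset.prod_congr rfl fun l _ => ?_
    split_ifs with hl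
    · subst hl
      simp only [Function.update_self, expCentredSqDeriv, p, τ, Option.elim]
      simp
      ring
    · rw [Function.update_of_ne (by simpa using hl)]
      exact hφ l ω
  simp only [e₁, e₂, e₃] at key
  have i₁ : Integrable (fun ω => Var[X s; P] *
      (Real.exp (K s ω) * ∏ l, expCentredSq P X K (t l) ω)) P :=
    (hKs.mul hφall).integrable.const_mul _
  have i₂ : Integrable (fun ω => cov[X s, K s; P] * (X s ω * Real.exp (K s ω)) *
      ∏ l, expCentredSq P X K (t l) ω) P :=
    (((HasAllMoments.const _).mul (hXs.mul hKs)).mul hφall).integrable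
  have hφs : HasAllMoments (fun ω => expCentredSq P X K s ω) P := by
    have := (hXs.eval (.X ^ 2 - .C Var[X s; P])).mul hKs
    simpa [expCentredSq] using this
  -- The variance term now stands on both sides and drops out.
  rw [integral_add (hφs.mul hφall).integrable i₁, integral_add i₂ i₁] at key
  linarith

end WeightedGaussianField

end GaussianField

/-! ### Integration by parts for powers of the spatial average -/

section GaussianFieldMoments

variable {Ω T : Type*} [MeasurableSpace Ω] [MeasurableSpace T] {P : Measure Ω} {μ : Measure T}

theorem MeasureTheory.Integrable.pow_of_pow_le [IsFiniteMeasure μ] {f : T → ℝ}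
    (hf : AEStronglyMeasurable f μ) (h₀ : ∀ t, 0 ≤ f t) {m n : ℕ} (hmn : m ≤ n)
    (hi : Integrable (fun t => f t ^ n) μ) : Integrable (fun t => f t ^ m) μ := by
  refine ((integrable_const (1 : ℝ)).add hi).mono' (hf.pow m) (ae_of_all _ fun t => ?_)
  rw [Real.norm_of_nonneg (pow_nonneg (h₀ t) m)]
  simp only [Pi.add_apply]
  rcases le_total (f t) 1 with h | h
  · have := pow_le_one₀ (n := m) (h₀ t) h
    have := pow_nonneg (h₀ t) n
    linarith
  · have := pow_le_pow_right₀ h hmn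
    linarith

theorem pow_integral_le_integral_pow [IsProbabilityMeasure μ] {f : T → ℝ}
    (hf : AEStronglyMeasurable f μ) (h₀ : ∀ t, 0 ≤ f t) (n : ℕ)
    (hi : Integrable (fun t => f t ^ n) μ) : (∫ t, f t ∂μ) ^ n ≤ ∫ t, f t ^ n ∂μ := by
  rcases Nat.eq_zero_or_pos n with rfl | hn
  · simp
  have h1 : Integrable f μ := by simpa using Integrable.pow_of_pow_le hf h₀ hn hi
  exact (convexOn_pow n).map_integral_le (continuous_pow n).continuousOn isClosed_Ici
    (ae_of_all _ fun t => h₀ t) h1 hi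

/-- A function on `Ω × T × T ^ k` bounded by a product of envelopes is integrable. -/
theorem integrable_of_abs_le_envelope_prod [IsProbabilityMeasure P] [IsProbabilityMeasure μ] {k : ℕ}
    {B : T → Ω → ℝ} (h₀ : ∀ t ω, 0 ≤ B t ω) (hBm : Measurable fun p : Ω × T => B p.2 p.1)
    (hBi : Integrable (fun p : Ω × T => B p.2 p.1 ^ (k + 1)) (P.prod μ))
    {F : Ω × T × (Fin k → T) → ℝ} (hFm : Measurable F) {C : ℝ}
    (hF : ∀ ω s t, |F (ω, s, t)| ≤ C * (B s ω * ∏ l, B (t l) ω)) :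
    Integrable F (P.prod (μ.prod (Measure.pi fun _ => μ))) := by
  have hGm : Measurable fun q : Ω × T × (Fin k → T) => B q.2.1 q.1 * ∏ l, B (q.2.2 l) q.1 := by
    refine (hBm.comp (measurable_fst.prodMk (measurable_fst.comp measurable_snd))).mul
      (Finset.measurable_prod _ fun l _ => hBm.comp (measurable_fst.prodMk ?_))
    fun_prop
  have hBω : ∀ ω, Measurable fun t => B t ω :=
    fun ω => hBm.comp (measurable_const.prodMk measurable_id)
  have hG : Integrable (fun q : Ω × T × (Fin k → T) => B q.2.1 q.1 * ∏ l, B (q.2.2 l) q.1)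
      (P.prod (μ.prod (Measure.pi fun _ => μ))) := by
    rw [integrable_prod_iff hGm.aestronglyMeasurable]
    constructor
    · filter_upwards [hBi.prod_right_ae] with ω hω
      have h1 : Integrable (fun t => B t ω) μ := by
        simpa using Integrable.pow_of_pow_le (hBω ω).aestronglyMeasurable (fun t => h₀ t ω)
          (Nat.le_add_left 1 k) hω
      exact Integrable.mul_prod h1 (Integrable.fintype_prod fun _ => h1)
    -- For fixed ω the product integrates to the (k+1)-st power of the mean of B, which Jensen
    -- bounds by the mean of B^(k+1).
    · have e : ∀ ω, ∫ q : T × (Fin k → T), ‖B q.1 ω * ∏ l, B (q.2 l) ω‖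
          ∂(μ.prod (Measure.pi fun _ => μ)) = (∫ t, B t ω ∂μ) ^ (k + 1) := by
        intro ω
        have : ∀ q : T × (Fin k → T), ‖B q.1 ω * ∏ l, B (q.2 l) ω‖ =
            B q.1 ω * ∏ l, B (q.2 l) ω := fun q =>
          Real.norm_of_nonneg (mul_nonneg (h₀ _ _) (Finset.prod_nonneg fun _ _ => h₀ _ _))
        simp only [this]
        rw [integral_prod_mul (f := fun t => B t ω) (g := fun t : Fin k → T => ∏ l, B (t l) ω),
          integral_fintype_prod_eq_pow (fun t => B t ω), Fintype.card_fin, pow_succ']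
      simp only [e]
      refine hBi.integral_prod_left.mono'
        ((hBm.stronglyMeasurable.integral_prod_right' (ν := μ)).aestronglyMeasurable.pow _) ?_
      filter_upwards [hBi.prod_right_ae] with ω hω
      rw [Real.norm_of_nonneg (pow_nonneg (integral_nonneg fun t => h₀ t ω) _)]
      exact pow_integral_le_integral_pow (hBω ω).aestronglyMeasurable (fun t => h₀ t ω) _ hω
  exact (hG.const_mul C).mono' hFm.aestronglyMeasurable (ae_of_all _ fun q => hF q.1 q.2.1 q.2.2)

variable {X K : T → Ω → ℝ} {w : T → ℝ}

/-- The spatial average of `expCentredSq`. -/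
noncomputable def avgExpCentredSq (P : Measure Ω) (μ : Measure T) (X K : T → Ω → ℝ) (ω : Ω) : ℝ :=
  ∫ t, expCentredSq P X K t ω ∂μ

/-- The term of the integration by parts coming from `K` at the same point. -/
noncomputable def avgDiagonal (P : Measure Ω) (μ : Measure T) (X K : T → Ω → ℝ) (ω : Ω) : ℝ :=
  ∫ s, cov[X s, K s; P] * (X s ω * Real.exp (K s ω)) ∂μ

/-- The term of the integration by parts coming from pairs of points. -/
noncomputable def avgOffDiagonal (P : Measure Ω) (μ : Measure T) (X K : T → Ω → ℝ) (ω : Ω) : ℝ :=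
  ∫ s, X s ω * Real.exp (K s ω) * ∫ t, expCentredSqDeriv P X K s t ω ∂μ ∂μ

namespace WeightedGaussianField

theorem measurable_avgExpCentredSq [SFinite μ] (hF : WeightedGaussianField P X K w) :
    Measurable (avgExpCentredSq P μ X K) :=
  (hF.measurable_expCentredSq.stronglyMeasurable.integral_prod_right' (ν := μ)).measurable

theorem measurable_mul_exp (hF : WeightedGaussianField P X K w) :
    Measurable fun p : Ω × T => X p.2 p.1 * Real.exp (K p.2 p.1) :=
  hF.measurable_left.mul hF.measurable_right.exp

theorem measurable_diagonal (hF : WeightedGaussianField P X K w) :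
    Measurable fun p : Ω × T =>
      cov[X p.2, K p.2; P] * (X p.2 p.1 * Real.exp (K p.2 p.1)) := by
  have : Measurable fun p : Ω × T => cov[X p.2, K p.2; P] :=
    hF.measurable_covariance_right.comp (measurable_snd.prodMk measurable_snd)
  exact this.mul hF.measurable_mul_exp

theorem abs_diagonal_le (hF : WeightedGaussianField P X K w) {b : ℝ} {s : T}
    (hb : |cov[X s, K s; P]| ≤ b * (w s * w s)) (hb₀ : 0 ≤ b) (ω : Ω) :
    |cov[X s, K s; P] * (X s ω * Real.exp (K s ω))| ≤ b * fieldEnvelope X K w s ω := by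
  rw [abs_mul, abs_mul, Real.abs_exp]
  calc |cov[X s, K s; P]| * (|X s ω| * Real.exp (K s ω))
      ≤ b * (w s * w s) * (|X s ω| * Real.exp (K s ω)) := by gcongr
    _ = b * (w s * w s * |X s ω| * Real.exp (K s ω)) := by ring
    _ ≤ _ := by
      gcongr
      exact hF.weight_sq_mul_abs_mul_exp_le s ω

theorem abs_mul_exp_mul_deriv_le (hF : WeightedGaussianField P X K w) {a b : ℝ} {s t : T}
    (ha : |cov[X s, X t; P]| ≤ a * (w s * w t)) (hb : |cov[X s, K t; P]| ≤ b * (w s * w t))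
    (hba : b ≤ a) (hb₀ : 0 ≤ b) (ω : Ω) :
    |X s ω * Real.exp (K s ω) * expCentredSqDeriv P X K s t ω| ≤
      2 * a * (fieldEnvelope X K w s ω * fieldEnvelope X K w t ω) := by
  rw [abs_mul, abs_mul, Real.abs_exp]
  have h₁ := hF.fieldEnvelope_nonneg t ω
  have ha₀ : 0 ≤ a := hb₀.trans hba
  calc |X s ω| * Real.exp (K s ω) * |expCentredSqDeriv P X K s t ω|
      ≤ |X s ω| * Real.exp (K s ω) * (w s * (2 * a * fieldEnvelope X K w t ω)) := by
        gcongr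
        exact hF.abs_expCentredSqDeriv_le ha hb hba hb₀ ω
    _ = (w s * |X s ω| * Real.exp (K s ω)) * (2 * a * fieldEnvelope X K w t ω) := by ring
    _ ≤ fieldEnvelope X K w s ω * (2 * a * fieldEnvelope X K w t ω) := by
        gcongr
        exact hF.weight_mul_abs_mul_exp_le s ω
    _ = _ := by ring

theorem prod_ite_deriv {k : ℕ} (j : Fin k) (s : T) (t : Fin k → T) (ω : Ω) :
    ∏ l, (if l = j then expCentredSqDeriv P X K s (t l) ω else expCentredSq P X K (t l) ω) =
      expCentredSqDeriv P X K s (t j) ω *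
        ∏ l ∈ Finset.univ.erase j, expCentredSq P X K (t l) ω := by
  rw [← Finset.mul_prod_erase _ _ (Finset.mem_univ j), if_pos rfl]
  congr 1
  exact Finset.prod_congr rfl fun l hl => by rw [if_neg (Finset.ne_of_mem_erase hl)]

theorem prod_abs_expCentredSq_le (hF : WeightedGaussianField P X K w) {ι : Type*} (S : Finset ι)
    (t : ι → T) (ω : Ω) :
    |∏ l ∈ S, expCentredSq P X K (t l) ω| ≤ ∏ l ∈ S, fieldEnvelope X K w (t l) ω := by
  rw [Finset.abs_prod]
  exact Finset.prod_le_prod (fun _ _ => abs_nonneg _) fun l _ => hF.abs_expCentredSq_le (t l) ω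

/-- Integration by parts for the powers of the spatial average. -/
theorem integral_avg_pow_succ [IsProbabilityMeasure μ] (hF : WeightedGaussianField P X K w) {k : ℕ}
    (hBi : Integrable (fun p : Ω × T => fieldEnvelope X K w p.2 p.1 ^ (k + 1)) (P.prod μ)) :
    ∫ ω, avgExpCentredSq P μ X K ω ^ (k + 1) ∂P =
      ∫ ω, avgDiagonal P μ X K ω * avgExpCentredSq P μ X K ω ^ k ∂P +
        k * ∫ ω, avgOffDiagonal P μ X K ω * avgExpCentredSq P μ X K ω ^ (k - 1) ∂P := by
  have := hF.isProbabilityMeasure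
  have hE := hF.fieldEnvelope_nonneg
  let F₁ : Ω × T × (Fin k → T) → ℝ := fun q =>
    expCentredSq P X K q.2.1 q.1 * ∏ l, expCentredSq P X K (q.2.2 l) q.1
  let F₂ : Ω × T × (Fin k → T) → ℝ := fun q =>
    cov[X q.2.1, K q.2.1; P] * (X q.2.1 q.1 * Real.exp (K q.2.1 q.1)) *
      ∏ l, expCentredSq P X K (q.2.2 l) q.1
  let F₃ : Fin k → Ω × T × (Fin k → T) → ℝ := fun j q =>
    X q.2.1 q.1 * Real.exp (K q.2.1 q.1) *
      ∏ l, (if l = j then expCentredSqDeriv P X K q.2.1 (q.2.2 l) q.1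
        else expCentredSq P X K (q.2.2 l) q.1)
  have m₁ : Measurable fun q : Ω × T × (Fin k → T) => (q.1, q.2.1) := by fun_prop
  have m₂ : ∀ l, Measurable fun q : Ω × T × (Fin k → T) => (q.1, q.2.2 l) := fun l => by fun_prop
  have m₃ : ∀ l, Measurable fun q : Ω × T × (Fin k → T) => (q.1, q.2.1, q.2.2 l) :=
    fun l => by fun_prop
  have mφ : ∀ l, Measurable fun q : Ω × T × (Fin k → T) => expCentredSq P X K (q.2.2 l) q.1 :=
    fun l => hF.measurable_expCentredSq.comp (m₂ l)
  have i₁ : Integrable F₁ (P.prod (μ.prod (Measure.pi fun _ => μ))) := by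
    refine integrable_of_abs_le_envelope_prod hE hF.measurable_fieldEnvelope hBi
      ((hF.measurable_expCentredSq.comp m₁).mul (Finset.measurable_prod _ fun l _ => mφ l))
      (C := 1) fun ω s t => ?_
    rw [one_mul, abs_mul]
    exact mul_le_mul (hF.abs_expCentredSq_le s ω) (hF.prod_abs_expCentredSq_le _ t ω)
      (abs_nonneg _) (hE s ω)
  have i₂ : Integrable F₂ (P.prod (μ.prod (Measure.pi fun _ => μ))) := by
    refine integrable_of_abs_le_envelope_prod hE hF.measurable_fieldEnvelope hBi
      ((hF.measurable_diagonal.comp m₁).mul (Finset.measurable_prod _ fun l _ => mφ l))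
      (C := 1) fun ω s t => ?_
    rw [one_mul, abs_mul]
    refine mul_le_mul ?_ (hF.prod_abs_expCentredSq_le _ t ω) (abs_nonneg _) (hE s ω)
    simpa using hF.abs_diagonal_le (b := 1) (by simpa using hF.abs_covariance_right_le s s)
      zero_le_one ω
  have i₃ : ∀ j, Integrable (F₃ j) (P.prod (μ.prod (Measure.pi fun _ => μ))) := by
    intro j
    refine integrable_of_abs_le_envelope_prod hE hF.measurable_fieldEnvelope hBi
      ((hF.measurable_mul_exp.comp m₁).mul (Finset.measurable_prod _ fun l _ => ?_))
      (C := 2) fun ω s t => ?_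
    · split_ifs
      · exact hF.measurable_expCentredSqDeriv.comp (m₃ l)
      · exact mφ l
    · simp only [F₃]
      rw [prod_ite_deriv, ← mul_assoc, abs_mul, ← Finset.mul_prod_erase _ _ (Finset.mem_univ j),
        ← mul_assoc, ← mul_assoc]
      refine mul_le_mul ?_ (hF.prod_abs_expCentredSq_le _ t ω) (abs_nonneg _) ?_
      · have := hF.abs_mul_exp_mul_deriv_le (a := 1) (b := 1)
          (by simpa using hF.abs_covariance_left_le s (t j))
          (by simpa using hF.abs_covariance_right_le s (t j)) le_rfl zero_le_one ω
        simpa [mul_assoc] using this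
      · have := hE s ω
        have := hE (t j) ω
        positivity
  have e₁ : ∫ q, ∫ ω, F₁ (ω, q) ∂P ∂(μ.prod (Measure.pi fun _ => μ)) =
      ∫ ω, avgExpCentredSq P μ X K ω ^ (k + 1) ∂P := by
    rw [← integral_integral_swap i₁]
    congr 1 with ω
    simp only [F₁]
    rw [integral_prod_mul (f := fun s => expCentredSq P X K s ω)
      (g := fun t : Fin k → T => ∏ l, expCentredSq P X K (t l) ω),
      integral_fintype_prod_eq_pow (fun t => expCentredSq P X K t ω), Fintype.card_fin, pow_succ']
    rfl
  have e₂ : ∫ q, ∫ ω, F₂ (ω, q) ∂P ∂(μ.prod (Measure.pi fun _ => μ)) =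
      ∫ ω, avgDiagonal P μ X K ω * avgExpCentredSq P μ X K ω ^ k ∂P := by
    rw [← integral_integral_swap i₂]
    congr 1 with ω
    simp only [F₂]
    rw [integral_prod_mul (f := fun s => cov[X s, K s; P] * (X s ω * Real.exp (K s ω)))
      (g := fun t : Fin k → T => ∏ l, expCentredSq P X K (t l) ω),
      integral_fintype_prod_eq_pow (fun t => expCentredSq P X K t ω), Fintype.card_fin]
    rfl
  -- For fixed ω each coordinate other than s and t_j integrates to the average W, leaving W^(k−1).
  -- The value does not depend on j, whence the factor k. For k = 0 there is no j, and the truncated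
  -- exponent k − 1 plays no role.
  have e₃ : ∀ j, ∫ q, ∫ ω, F₃ j (ω, q) ∂P ∂(μ.prod (Measure.pi fun _ => μ)) =
      ∫ ω, avgOffDiagonal P μ X K ω * avgExpCentredSq P μ X K ω ^ (k - 1) ∂P := by
    intro j
    rw [← integral_integral_swap (i₃ j)]
    refine integral_congr_ae ?_
    filter_upwards [(i₃ j).prod_right_ae] with ω hω
    rw [integral_prod _ hω]
    simp only [F₃, avgOffDiagonal]
    rw [← integral_mul_const]
    congr 1 with s
    rw [integral_const_mul, mul_assoc (X s ω * Real.exp (K s ω))]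
    congr 1
    rw [integral_fintype_prod_eq_prod (f := fun l t =>
      if l = j then expCentredSqDeriv P X K s t ω else expCentredSq P X K t ω),
      ← Finset.mul_prod_erase _ _ (Finset.mem_univ j)]
    simp only [if_true]
    congr 1
    rw [Finset.prod_congr rfl (g := fun _ => avgExpCentredSq P μ X K ω) fun l hl => by
      simp only [if_neg (Finset.ne_of_mem_erase hl)]; rfl]
    simp
  have key : ∀ q : T × (Fin k → T), ∫ ω, F₁ (ω, q) ∂P =
      ∫ ω, F₂ (ω, q) ∂P + ∑ j, ∫ ω, F₃ j (ω, q) ∂P :=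
    fun q => hF.integral_expCentredSq_mul_prod q.1 q.2
  rw [← e₁]
  simp only [key]
  rw [integral_add i₂.integral_prod_right
    (integrable_finsetSum _ fun j _ => (i₃ j).integral_prod_right),
    integral_finsetSum _ fun j _ => (i₃ j).integral_prod_right, e₂]
  simp [e₃]

end WeightedGaussianField

end GaussianFieldMoments

/-! ### Smallness of the even moments of the spatial average -/

section AverageMomentBound

/-- A crude Young inequality, by comparing 4a with u. The factor 1/4 is chosen so that two
applications cost half of the quantity being estimated. -/
theorem mul_pow_pred_le {a u : ℝ} (ha : 0 ≤ a) (hu : 0 ≤ u) {n : ℕ} (hn : 1 ≤ n) :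
    a * u ^ (n - 1) ≤ u ^ n / 4 + (4 * a) ^ n := by
  obtain ⟨k, rfl⟩ := Nat.exists_eq_add_of_le' hn
  simp only [Nat.add_sub_cancel]
  rcases le_total (4 * a) u with h | h
  · have h₁ : 4 * a * u ^ k ≤ u * u ^ k := by gcongr
    have h₂ : 0 ≤ (4 * a) ^ (k + 1) := by positivity
    rw [pow_succ' u]
    linarith
  · have h₁ : a * u ^ k ≤ (4 * a) * (4 * a) ^ k := by
      gcongr
      linarith
    have h₂ : 0 ≤ u ^ (k + 1) := by positivity
    rw [pow_succ' (4 * a)]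
    linarith

theorem abs_integral_le_of_abs_le {α : Type*} [MeasurableSpace α] {m : Measure α} {f g : α → ℝ}
    (hg : Integrable g m) (h : ∀ᵐ a ∂m, |f a| ≤ g a) : |∫ a, f a ∂m| ≤ ∫ a, g a ∂m :=
  norm_integral_le_of_norm_le (f := f) hg h

variable {Ω T : Type*} [MeasurableSpace Ω] [MeasurableSpace T] {P : Measure Ω} {μ : Measure T}
  {X K : T → Ω → ℝ} {w : T → ℝ}

namespace WeightedGaussianField

theorem measurable_fieldEnvelope_apply (hF : WeightedGaussianField P X K w) (ω : Ω) :
    Measurable fun t => fieldEnvelope X K w t ω :=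
  hF.measurable_fieldEnvelope.comp (measurable_const.prodMk measurable_id)

variable (hF : WeightedGaussianField P X K w) {r : ℕ} {ω : Ω}

include hF

theorem integrable_fieldEnvelope_pow [IsProbabilityMeasure μ] {m n : ℕ} (hmn : m ≤ n)
    (hi : Integrable (fun t => fieldEnvelope X K w t ω ^ n) μ) :
    Integrable (fun t => fieldEnvelope X K w t ω ^ m) μ :=
  hi.pow_of_pow_le (hF.measurable_fieldEnvelope_apply ω).aestronglyMeasurable
    (fun t => hF.fieldEnvelope_nonneg t ω) hmn

theorem abs_avgExpCentredSq_le
    (hi : Integrable (fun t => fieldEnvelope X K w t ω) μ) :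
    |avgExpCentredSq P μ X K ω| ≤ ∫ t, fieldEnvelope X K w t ω ∂μ :=
  abs_integral_le_of_abs_le hi (ae_of_all _ fun t => hF.abs_expCentredSq_le t ω)

theorem abs_avgDiagonal_le {ε : ℝ} (hε : 0 ≤ ε)
    (hc : ∀ s t, |cov[X s, K t; P]| ≤ ε * (w s * w t))
    (hi : Integrable (fun t => fieldEnvelope X K w t ω) μ) :
    |avgDiagonal P μ X K ω| ≤ ε * ∫ t, fieldEnvelope X K w t ω ∂μ := by
  rw [← integral_const_mul]
  exact abs_integral_le_of_abs_le (hi.const_mul ε)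
    (ae_of_all _ fun s => hF.abs_diagonal_le (hc s s) hε ω)

/-- Pairs in S contribute order ε. On the complement only the trivial covariance bound between
values of X is available; Cauchy–Schwarz trades the indicator for the square root of its mass, at
the price of squaring the envelope. -/
theorem abs_avgOffDiagonal_le [IsProbabilityMeasure μ] {ε : ℝ} (hε : 0 ≤ ε) (hε₁ : ε ≤ 1)
    {S : Set (T × T)}
    (hS : MeasurableSet S)
    (hc : ∀ s t, |cov[X s, K t; P]| ≤ ε * (w s * w t))
    (hr : ∀ s t, (s, t) ∈ S → |cov[X s, X t; P]| ≤ ε * (w s * w t))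
    (hi : Integrable (fun t => fieldEnvelope X K w t ω ^ 2) μ) :
    |avgOffDiagonal P μ X K ω| ≤
      2 * (ε + √((μ.prod μ).real Sᶜ)) * ∫ t, fieldEnvelope X K w t ω ^ 2 ∂μ := by
  have hB := hF.measurable_fieldEnvelope_apply ω
  have h₀ : ∀ t, 0 ≤ fieldEnvelope X K w t ω := fun t => hF.fieldEnvelope_nonneg t ω
  set b : T → ℝ := fun t => fieldEnvelope X K w t ω with hb
  have i₁ : Integrable b μ := by
    simpa using hF.integrable_fieldEnvelope_pow one_le_two hi
  have i₂ : Integrable (fun q : T × T => b q.1 * b q.2) (μ.prod μ) := i₁.mul_prod i₁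
  let f : T × T → ℝ := Sᶜ.indicator 1
  have hf : Measurable f := measurable_one.indicator hS.compl
  have hf₀ : ∀ q, 0 ≤ f q := fun q => Set.indicator_nonneg (fun _ _ => zero_le_one) q
  have hf₁ : ∀ q, f q ≤ 1 := fun q => Set.indicator_le_self' (fun _ _ => zero_le_one) q
  let H : T × T → ℝ := fun q =>
    X q.1 ω * Real.exp (K q.1 ω) * expCentredSqDeriv P X K q.1 q.2 ω
  have hHm : Measurable H :=
    (hF.measurable_mul_exp.comp (measurable_const.prodMk measurable_fst)).mul
      (hF.measurable_expCentredSqDeriv.comp (measurable_const.prodMk measurable_id))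
  have hfb : Integrable (fun q => f q * (b q.1 * b q.2)) (μ.prod μ) := by
    refine i₂.mono' (hf.mul ((hB.comp measurable_fst).mul
      (hB.comp measurable_snd))).aestronglyMeasurable (ae_of_all _ fun q => ?_)
    have := mul_nonneg (h₀ q.1) (h₀ q.2)
    rw [Real.norm_of_nonneg (mul_nonneg (hf₀ q) this)]
    exact mul_le_of_le_one_left this (hf₁ q)
  have hHle : ∀ q, |H q| ≤ 2 * ε * (b q.1 * b q.2) + 2 * (f q * (b q.1 * b q.2)) := by
    intro q
    have hbb := mul_nonneg (h₀ q.1) (h₀ q.2)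
    by_cases hq : q ∈ S
    · have := hF.abs_mul_exp_mul_deriv_le (hr q.1 q.2 hq) (hc q.1 q.2) le_rfl hε ω
      have hfq := mul_nonneg (hf₀ q) hbb
      linarith
    · have := hF.abs_mul_exp_mul_deriv_le (a := 1)
        (by simpa using hF.abs_covariance_left_le q.1 q.2) (hc q.1 q.2) hε₁ hε ω
      have hfq : f q = 1 := Set.indicator_of_mem (Set.mem_compl hq) _
      rw [hfq]
      have := mul_nonneg hε hbb
      linarith
  have hG := (i₂.const_mul (2 * ε)).add (hfb.const_mul 2)
  have hHi : Integrable H (μ.prod μ) := hG.mono' hHm.aestronglyMeasurable (ae_of_all _ hHle)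
  have hQ : avgOffDiagonal P μ X K ω = ∫ q, H q ∂(μ.prod μ) := by
    rw [integral_prod _ hHi]
    simp only [H, avgOffDiagonal, integral_const_mul]
  -- Cauchy–Schwarz; an indicator equals its square, and the square integral of b(s) b(t)
  -- factorises.
  have cs : ∫ q, f q * (b q.1 * b q.2) ∂(μ.prod μ) ≤
      √((μ.prod μ).real Sᶜ) * ∫ t, b t ^ 2 ∂μ := by
    have hmem : MemLp (fun q : T × T => b q.1 * b q.2) (ENNReal.ofReal 2) (μ.prod μ) := by
      have h2 : ENNReal.ofReal 2 = 2 := by norm_num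
      rw [h2, memLp_two_iff_integrable_sq i₂.aestronglyMeasurable]
      simp only [mul_pow]
      exact hi.mul_prod hi
    have := integral_mul_le_Lp_mul_Lq_of_nonneg (p := 2) (q := 2) (μ := μ.prod μ)
      Real.HolderConjugate.two_two (f := f)
      (ae_of_all _ hf₀) (g := fun q : T × T => b q.1 * b q.2)
      (ae_of_all _ fun q => mul_nonneg (h₀ q.1) (h₀ q.2))
      (MemLp.of_bound hf.aestronglyMeasurable 1 (ae_of_all _ fun q => by
        rw [Real.norm_of_nonneg (hf₀ q)]; exact hf₁ q)) hmem
    refine this.trans (le_of_eq ?_)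
    simp only [Real.rpow_two, ← Real.sqrt_eq_rpow, mul_pow]
    rw [integral_prod_mul (f := fun t => b t ^ 2) (g := fun t => b t ^ 2), ← sq,
      Real.sqrt_sq (integral_nonneg fun t => sq_nonneg _)]
    congr 2
    have : ∀ q, f q ^ 2 = Sᶜ.indicator 1 q := fun q => by
      by_cases hq : q ∈ Sᶜ <;> simp [f, hq]
    simp only [this]
    rw [integral_indicator_one hS.compl]
  have hsq : (∫ t, b t ∂μ) ^ 2 ≤ ∫ t, b t ^ 2 ∂μ :=
    pow_integral_le_integral_pow hB.aestronglyMeasurable h₀ 2 hi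
  calc |avgOffDiagonal P μ X K ω|
      ≤ ∫ q : T × T, (2 * ε * (b q.1 * b q.2) + 2 * (f q * (b q.1 * b q.2))) ∂(μ.prod μ) := by
        rw [hQ]
        exact abs_integral_le_of_abs_le hG (ae_of_all _ hHle)
    _ = 2 * ε * (∫ t, b t ∂μ) ^ 2 + 2 * ∫ q, f q * (b q.1 * b q.2) ∂(μ.prod μ) := by
        rw [integral_add (i₂.const_mul _) (hfb.const_mul _), integral_const_mul,
          integral_const_mul, integral_prod_mul, sq]
    _ ≤ 2 * ε * (∫ t, b t ^ 2 ∂μ) + 2 * (√((μ.prod μ).real Sᶜ) * ∫ t, b t ^ 2 ∂μ) := by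
        gcongr
    _ = _ := by ring

/-- The even moments of the spatial average of `expCentredSq` are small when the covariances are
small away from a small set of pairs. -/
theorem integral_avg_pow_le [IsProbabilityMeasure μ] (hr₁ : 1 ≤ r) {ε : ℝ} (hε : 0 ≤ ε) (hε₁ : ε ≤ 1)
    {S : Set (T × T)}
    (hS : MeasurableSet S)
    (hc : ∀ s t, |cov[X s, K t; P]| ≤ ε * (w s * w t))
    (hr : ∀ s t, (s, t) ∈ S → |cov[X s, X t; P]| ≤ ε * (w s * w t))
    (hBi : Integrable (fun p : Ω × T => fieldEnvelope X K w p.2 p.1 ^ (2 * r)) (P.prod μ)) :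
    Integrable (fun ω => avgExpCentredSq P μ X K ω ^ (2 * r)) P ∧
    ∫ ω, avgExpCentredSq P μ X K ω ^ (2 * r) ∂P ≤
      2 * (16 ^ r + (16 * r) ^ r) * (ε + √((μ.prod μ).real Sᶜ)) ^ r *
        ∫ p, fieldEnvelope X K w p.2 p.1 ^ (2 * r) ∂(P.prod μ) := by
  have := hF.isProbabilityMeasure
  set δ := (μ.prod μ).real Sᶜ
  set W := avgExpCentredSq P μ X K
  set V : Ω → ℝ := fun ω => ∫ t, fieldEnvelope X K w t ω ^ (2 * r) ∂μ with hV
  have hVi : Integrable V P := hBi.integral_prod_left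
  have hVeq : ∫ ω, V ω ∂P = ∫ p, fieldEnvelope X K w p.2 p.1 ^ (2 * r) ∂(P.prod μ) :=
    (integral_prod _ hBi).symm
  have hae := hBi.prod_right_ae
  have hpow : ∀ ω n, n ≤ 2 * r → Integrable (fun t => fieldEnvelope X K w t ω ^ (2 * r)) μ →
      Integrable (fun t => fieldEnvelope X K w t ω ^ n) μ :=
    fun ω n hn hi => hF.integrable_fieldEnvelope_pow hn hi
  have hW : ∀ᵐ ω ∂P, W ω ^ (2 * r) ≤ V ω := by
    filter_upwards [hae] with ω hω
    have h1 : Integrable (fun t => fieldEnvelope X K w t ω) μ := by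
      simpa using hpow ω 1 (by omega) hω
    rw [← (even_two_mul r).pow_abs]
    exact (pow_le_pow_left₀ (abs_nonneg _) (hF.abs_avgExpCentredSq_le h1) _).trans
      (pow_integral_le_integral_pow (hF.measurable_fieldEnvelope_apply ω).aestronglyMeasurable
        (fun t => hF.fieldEnvelope_nonneg t ω) _ hω)
  have hR : ∀ᵐ ω ∂P, |avgDiagonal P μ X K ω| ^ (2 * r) ≤ ε ^ (2 * r) * V ω := by
    filter_upwards [hae] with ω hω
    have h1 : Integrable (fun t => fieldEnvelope X K w t ω) μ := by
      simpa using hpow ω 1 (by omega) hω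
    refine (pow_le_pow_left₀ (abs_nonneg _) (hF.abs_avgDiagonal_le hε hc h1) _).trans ?_
    rw [mul_pow]
    gcongr
    exact pow_integral_le_integral_pow (hF.measurable_fieldEnvelope_apply ω).aestronglyMeasurable
        (fun t => hF.fieldEnvelope_nonneg t ω) _ hω
  have hQ : ∀ᵐ ω ∂P, |avgOffDiagonal P μ X K ω| ^ r ≤ (2 * (ε + √δ)) ^ r * V ω := by
    filter_upwards [hae] with ω hω
    have h2 := hpow ω 2 (by omega) hω
    refine (pow_le_pow_left₀ (abs_nonneg _)
      (hF.abs_avgOffDiagonal_le hε hε₁ hS hc hr h2) _).trans ?_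
    rw [mul_pow]
    gcongr
    have := pow_integral_le_integral_pow (μ := μ) (f := fun t => fieldEnvelope X K w t ω ^ 2)
      ((hF.measurable_fieldEnvelope_apply ω).pow_const 2).aestronglyMeasurable
        (fun t => sq_nonneg _) r (by simpa only [← pow_mul] using hω)
    simpa only [← pow_mul] using this
  have hWi : Integrable (fun ω => W ω ^ (2 * r)) P := by
    refine hVi.mono' (hF.measurable_avgExpCentredSq.pow_const _).aestronglyMeasurable ?_
    filter_upwards [hW] with ω hω
    rwa [Real.norm_of_nonneg ((even_two_mul r).pow_nonneg _)]
  refine ⟨hWi, ?_⟩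
  have key := hF.integral_avg_pow_succ (μ := μ) (k := 2 * r - 1)
    (by rwa [Nat.sub_add_cancel (by omega)])
  rw [Nat.sub_add_cancel (by omega)] at key
  -- Young with exponent 2r and u = |W|.
  have b₁ : ∫ ω, avgDiagonal P μ X K ω * W ω ^ (2 * r - 1) ∂P ≤
      ∫ ω, (W ω ^ (2 * r) / 4 + 4 ^ (2 * r) * (ε ^ (2 * r) * V ω)) ∂P := by
    refine (le_abs_self _).trans (abs_integral_le_of_abs_le
      ((hWi.div_const 4).add ((hVi.const_mul _).const_mul _)) ?_)
    filter_upwards [hR] with ω hω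
    rw [abs_mul, abs_pow]
    have := mul_pow_pred_le (abs_nonneg (avgDiagonal P μ X K ω)) (abs_nonneg (W ω))
      (n := 2 * r) (by omega)
    rw [mul_pow, (even_two_mul r).pow_abs (W ω)] at this
    refine this.trans ?_
    gcongr
  -- Young with exponent r and u = W². The combinatorial factor 2r − 1 is put into a = 2r|Q|, whence
  -- (8r)^r.
  have b₂ : ((2 * r - 1 : ℕ) : ℝ) *
      ∫ ω, avgOffDiagonal P μ X K ω * W ω ^ (2 * r - 1 - 1) ∂P ≤
      ∫ ω, (W ω ^ (2 * r) / 4 + (8 * r) ^ r * ((2 * (ε + √δ)) ^ r * V ω)) ∂P := by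
    rw [← integral_const_mul]
    refine (le_abs_self _).trans (abs_integral_le_of_abs_le
      ((hWi.div_const 4).add ((hVi.const_mul _).const_mul _)) ?_)
    filter_upwards [hQ] with ω hω
    have h2r : ((2 * r - 1 : ℕ) : ℝ) ≤ 2 * r := by
      exact_mod_cast Nat.sub_le (2 * r) 1
    have e : 2 * r - 1 - 1 = 2 * (r - 1) := by omega
    rw [abs_mul, abs_mul, e, pow_mul, Nat.abs_cast,
      abs_of_nonneg (pow_nonneg (sq_nonneg (W ω)) (r - 1))]
    have := mul_pow_pred_le (a := 2 * r * |avgOffDiagonal P μ X K ω|) (by positivity)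
      (sq_nonneg (W ω)) hr₁
    calc ((2 * r - 1 : ℕ) : ℝ) * (|avgOffDiagonal P μ X K ω| * (W ω ^ 2) ^ (r - 1))
        ≤ (2 * r) * (|avgOffDiagonal P μ X K ω| * (W ω ^ 2) ^ (r - 1)) := by gcongr
      _ = (2 * r * |avgOffDiagonal P μ X K ω|) * (W ω ^ 2) ^ (r - 1) := by ring
      _ ≤ _ := this
      _ = W ω ^ (2 * r) / 4 + (8 * r) ^ r * |avgOffDiagonal P μ X K ω| ^ r := by
        rw [← pow_mul, ← mul_pow]
        congr 2
        ring
      _ ≤ _ := by gcongr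
  rw [integral_add (hWi.div_const 4) ((hVi.const_mul _).const_mul _), integral_div,
    integral_const_mul, integral_const_mul] at b₁ b₂
  have hV₀ : 0 ≤ ∫ ω, V ω ∂P := integral_nonneg fun ω => integral_nonneg fun t =>
    pow_nonneg (hF.fieldEnvelope_nonneg t ω) _
  -- The diagonal term is better than needed; since ε ≤ 1 it is weakened to the rate of the
  -- off-diagonal one.
  have hε₂ : ε ^ (2 * r) ≤ (ε + √δ) ^ r :=
    (pow_le_pow_of_le_one hε hε₁ (by omega : r ≤ 2 * r)).trans
      (pow_le_pow_left₀ hε (by linarith [Real.sqrt_nonneg δ]) r)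
  have c₁ : (4 : ℝ) ^ (2 * r) * (ε ^ (2 * r) * ∫ ω, V ω ∂P) ≤
      16 ^ r * ((ε + √δ) ^ r * ∫ ω, V ω ∂P) := by
    rw [pow_mul]
    norm_num
    gcongr
  have c₂ : (8 * r : ℝ) ^ r * ((2 * (ε + √δ)) ^ r * ∫ ω, V ω ∂P) =
      (16 * r) ^ r * ((ε + √δ) ^ r * ∫ ω, V ω ∂P) := by
    rw [mul_pow 2, ← mul_assoc, ← mul_assoc, ← mul_pow, ← mul_assoc]
    congr 3
    ring
  rw [← hVeq]
  -- The two quarters of E W^{2r} move to the left; doubling what remains gives the factor 2.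
  nlinarith [key, b₁, b₂, c₁, c₂]

end WeightedGaussianField

end AverageMomentBound

/-! ### Measures with densities ν₁, ν₂ and their moments -/

section DensityMeasure

/-- The measure with Lebesgue density `ν`. -/
noncomputable def densityMeasure (ν : ℝ → ℝ) : Measure ℝ :=
  volume.withDensity fun x => ENNReal.ofReal (ν x)

namespace IsDensityWithMoments

variable {ν ν₁ ν₂ : ℝ → ℝ}

theorem integrable (h : IsDensityWithMoments ν) : Integrable ν := by
  simpa using h.moments 0

theorem isProbabilityMeasure (h : IsDensityWithMoments ν) :
    IsProbabilityMeasure (densityMeasure ν) := by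
  constructor
  rw [densityMeasure, withDensity_apply _ MeasurableSet.univ, Measure.restrict_univ,
    ← ofReal_integral_eq_lintegral_ofReal h.integrable (ae_of_all _ h.nonneg),
    h.integral_eq_one, ENNReal.ofReal_one]

theorem integrable_densityMeasure_iff (h : IsDensityWithMoments ν) {f : ℝ → ℝ} :
    Integrable f (densityMeasure ν) ↔ Integrable fun x => f x * ν x := by
  rw [densityMeasure, integrable_withDensity_iff_integrable_smul' h.measurable.ennreal_ofReal
    (ae_of_all _ fun _ => ENNReal.ofReal_lt_top)]
  simp only [ENNReal.toReal_ofReal (h.nonneg _), smul_eq_mul, mul_comm]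

theorem densityMeasure_prod (h₁ : IsDensityWithMoments ν₁) (h₂ : IsDensityWithMoments ν₂) :
    (densityMeasure ν₁).prod (densityMeasure ν₂) =
      volume.withDensity fun p : ℝ × ℝ => ENNReal.ofReal (ν₁ p.1 * ν₂ p.2) := by
  have := h₁.isProbabilityMeasure
  have := h₂.isProbabilityMeasure
  simp only [ENNReal.ofReal_mul (h₁.nonneg _)]
  rw [Measure.volume_eq_prod, ← prod_withDensity h₁.measurable.ennreal_ofReal
    h₂.measurable.ennreal_ofReal]
  rfl

theorem measurable_mul (h₁ : IsDensityWithMoments ν₁) (h₂ : IsDensityWithMoments ν₂) :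
    Measurable fun p : ℝ × ℝ => ν₁ p.1 * ν₂ p.2 :=
  (h₁.measurable.comp measurable_fst).mul (h₂.measurable.comp measurable_snd)

theorem integrable_prod_iff (h₁ : IsDensityWithMoments ν₁) (h₂ : IsDensityWithMoments ν₂)
    {f : ℝ × ℝ → ℝ} :
    Integrable f ((densityMeasure ν₁).prod (densityMeasure ν₂)) ↔
      Integrable fun p : ℝ × ℝ => f p * (ν₁ p.1 * ν₂ p.2) := by
  rw [h₁.densityMeasure_prod h₂, integrable_withDensity_iff_integrable_smul'
    (h₁.measurable_mul h₂).ennreal_ofReal (ae_of_all _ fun _ => ENNReal.ofReal_lt_top)]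
  simp only [ENNReal.toReal_ofReal (mul_nonneg (h₁.nonneg _) (h₂.nonneg _)), smul_eq_mul, mul_comm]

theorem integral_prod_eq (h₁ : IsDensityWithMoments ν₁) (h₂ : IsDensityWithMoments ν₂)
    (f : ℝ × ℝ → ℝ) :
    ∫ p, f p ∂((densityMeasure ν₁).prod (densityMeasure ν₂)) =
      ∫ p : ℝ × ℝ, f p * (ν₁ p.1 * ν₂ p.2) := by
  rw [h₁.densityMeasure_prod h₂, integral_withDensity_eq_integral_toReal_smul
    (h₁.measurable_mul h₂).ennreal_ofReal (ae_of_all _ fun _ => ENNReal.ofReal_lt_top)]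
  simp only [ENNReal.toReal_ofReal (mul_nonneg (h₁.nonneg _) (h₂.nonneg _)), smul_eq_mul, mul_comm]

theorem lintegral_prod_eq (h₁ : IsDensityWithMoments ν₁) (h₂ : IsDensityWithMoments ν₂)
    {f : ℝ × ℝ → ℝ≥0∞} (hf : Measurable f) :
    ∫⁻ p, f p ∂((densityMeasure ν₁).prod (densityMeasure ν₂)) =
      ∫⁻ p : ℝ × ℝ, f p * ENNReal.ofReal (ν₁ p.1 * ν₂ p.2) := by
  rw [h₁.densityMeasure_prod h₂, lintegral_withDensity_eq_lintegral_mul _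
    (h₁.measurable_mul h₂).ennreal_ofReal hf]
  simp only [Pi.mul_apply, mul_comm]

theorem prod_prod_apply (h₁ : IsDensityWithMoments ν₁) (h₂ : IsDensityWithMoments ν₂)
    {S : Set ((ℝ × ℝ) × (ℝ × ℝ))} (hS : MeasurableSet S) :
    (((densityMeasure ν₁).prod (densityMeasure ν₂)).prod
      ((densityMeasure ν₁).prod (densityMeasure ν₂))) S =
      ∫⁻ p in S, ENNReal.ofReal (ν₁ p.1.1 * ν₂ p.1.2 * (ν₁ p.2.1 * ν₂ p.2.2)) := by
  have := h₁.isProbabilityMeasure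
  have := h₂.isProbabilityMeasure
  have i : SFinite (volume.withDensity fun p : ℝ × ℝ => ENNReal.ofReal (ν₁ p.1 * ν₂ p.2)) := by
    rw [← h₁.densityMeasure_prod h₂]
    infer_instance
  rw [h₁.densityMeasure_prod h₂, prod_withDensity (h₁.measurable_mul h₂).ennreal_ofReal
    (h₁.measurable_mul h₂).ennreal_ofReal, withDensity_apply _ hS, ← Measure.volume_eq_prod]
  simp only [← ENNReal.ofReal_mul (mul_nonneg (h₁.nonneg _) (h₂.nonneg _))]

theorem integrable_one_add_abs_pow (h : IsDensityWithMoments ν) (N : ℕ) :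
    Integrable (fun x => (1 + |x|) ^ N) (densityMeasure ν) := by
  have := h.isProbabilityMeasure
  have hk : ∀ k, Integrable (fun x : ℝ => |x| ^ k) (densityMeasure ν) := fun k =>
    h.integrable_densityMeasure_iff.2 (h.moments k)
  simp only [add_pow, one_pow, one_mul]
  exact integrable_finsetSum _ fun k _ => (hk _).mul_const _

theorem integrable_one_add_abs_add_abs_pow (h₁ : IsDensityWithMoments ν₁)
    (h₂ : IsDensityWithMoments ν₂) (N : ℕ) :
    Integrable (fun p : ℝ × ℝ => (1 + |p.1| + |p.2|) ^ N)
      ((densityMeasure ν₁).prod (densityMeasure ν₂)) := by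
  have := h₁.isProbabilityMeasure
  have := h₂.isProbabilityMeasure
  refine ((h₁.integrable_one_add_abs_pow N).mul_prod (h₂.integrable_one_add_abs_pow N)).mono'
    (by fun_prop) (ae_of_all _ fun p => ?_)
  rw [Real.norm_of_nonneg (by positivity), ← mul_pow]
  gcongr
  nlinarith [mul_nonneg (abs_nonneg p.1) (abs_nonneg p.2)]

end IsDensityWithMoments

end DensityMeasure

/-! ### Growth of multivariate polynomials -/

section PolynomialGrowth

theorem MvPolynomial.exists_abs_eval_le {k : ℕ} (p : MvPolynomial (Fin k) ℝ) :
    ∃ (A : ℝ) (N : ℕ), 0 ≤ A ∧ ∀ v : Fin k → ℝ,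
      |MvPolynomial.eval v p| ≤ A * (1 + ∑ i, |v i|) ^ N := by
  induction p using MvPolynomial.induction_on with
  | C a => exact ⟨|a|, 0, abs_nonneg a, fun v => by simp⟩
  | add p q hp hq =>
    obtain ⟨A, N, hA, h⟩ := hp
    obtain ⟨A', N', hA', h'⟩ := hq
    refine ⟨A + A', max N N', by positivity, fun v => ?_⟩
    have h1 : 1 ≤ 1 + ∑ i, |v i| := by
      linarith [Finset.sum_nonneg fun i (_ : i ∈ Finset.univ) => abs_nonneg (v i)]
    rw [map_add, add_mul]
    refine (abs_add_le _ _).trans (add_le_add ((h v).trans ?_) ((h' v).trans ?_))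
    · gcongr
      exact le_max_left _ _
    · gcongr
      exact le_max_right _ _
  | mul_X p i hp =>
    obtain ⟨A, N, hA, h⟩ := hp
    refine ⟨A, N + 1, hA, fun v => ?_⟩
    have h1 : 0 ≤ ∑ i, |v i| := Finset.sum_nonneg fun i _ => abs_nonneg (v i)
    have h2 : |v i| ≤ 1 + ∑ i, |v i| := by
      linarith [Finset.single_le_sum (fun i _ => abs_nonneg (v i)) (Finset.mem_univ i)]
    rw [map_mul, MvPolynomial.eval_X, abs_mul, pow_succ, ← mul_assoc]
    gcongr
    exact h v

end PolynomialGrowth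

/-! ### Almost sure convergence from summable moments -/

section AlmostSureConvergence

variable {Ω : Type*} [MeasurableSpace Ω] {P : Measure Ω}

/-- By Tonelli the sum of |f_n|^p has finite expectation, so it is finite almost surely and its
terms tend to zero. The sequence is shifted by one because the bounds start at n = 1. -/
theorem ae_tendsto_zero_of_integral_pow_le {f : ℕ → Ω → ℝ} {p : ℕ} (hp : p ≠ 0) {C s : ℝ}
    (hs : 1 < s) (hi : ∀ n, 1 ≤ n → Integrable (fun ω => |f n ω| ^ p) P)
    (hle : ∀ n : ℕ, 1 ≤ n → ∫ ω, |f n ω| ^ p ∂P ≤ C * (n : ℝ) ^ (-s)) :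
    ∀ᵐ ω ∂P, Tendsto (fun n => f n ω) atTop (𝓝 0) := by
  have hi' : ∀ n, Integrable (fun ω => |f (n + 1) ω| ^ p) P := fun n => hi _ (by omega)
  have hm : ∀ n, AEMeasurable (fun ω => ENNReal.ofReal (|f (n + 1) ω| ^ p)) P :=
    fun n => (hi' n).aemeasurable.ennreal_ofReal
  have hle' : ∀ n : ℕ, ∫⁻ ω, ENNReal.ofReal (|f (n + 1) ω| ^ p) ∂P ≤
      ENNReal.ofReal (C * ((n + 1 : ℕ) : ℝ) ^ (-s)) := fun n => by
    rw [← ofReal_integral_eq_lintegral_ofReal (hi' n) (ae_of_all _ fun ω => by positivity)]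
    exact ENNReal.ofReal_le_ofReal (hle _ (by omega))
  have hsum : Summable fun n : ℕ => C * ((n + 1 : ℕ) : ℝ) ^ (-s) :=
    ((summable_nat_add_iff 1).2 (Real.summable_nat_rpow.2 (by linarith))).mul_left C
  have hfin : ∫⁻ ω, ∑' n, ENNReal.ofReal (|f (n + 1) ω| ^ p) ∂P ≠ ∞ := by
    rw [lintegral_tsum hm]
    exact ne_top_of_le_ne_top hsum.tsum_ofReal_ne_top (ENNReal.tsum_le_tsum hle')
  filter_upwards [ae_lt_top' (AEMeasurable.tsum hm) hfin] with ω hω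
  have h₁ := ENNReal.tendsto_atTop_zero_of_tsum_ne_top hω.ne
  have h₂ : Tendsto (fun n => |f (n + 1) ω| ^ p) atTop (𝓝 0) := by
    have := (ENNReal.tendsto_toReal ENNReal.zero_ne_top).comp h₁
    simpa [Function.comp_def, ENNReal.toReal_ofReal (pow_nonneg (abs_nonneg _) p)] using this
  have h₃ : Tendsto (fun n => |f (n + 1) ω|) atTop (𝓝 0) := by
    have := h₂.rpow_const (p := (p : ℝ)⁻¹) (Or.inr (by positivity))
    simpa [Real.pow_rpow_inv_natCast (abs_nonneg _) hp, Real.zero_rpow (inv_ne_zero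
      (Nat.cast_ne_zero.2 hp))] using this
  exact (tendsto_add_atTop_iff_nat 1).1 ((tendsto_zero_iff_abs_tendsto_zero _).2 h₃)

end AlmostSureConvergence

/-! ### The substitution y = x + σ z -/

section ChangeOfVariables

/-- The change of variables `(x, z) ↦ (x, x + σ z)`. -/
noncomputable def shearScale {σ : ℝ} (hσ : σ ≠ 0) : ℝ × ℝ ≃ᵐ ℝ × ℝ :=
  ((MeasurableEquiv.refl ℝ).prodCongr (MeasurableEquiv.mulLeft₀ σ hσ)).trans
    (MeasurableEquiv.shearAddRight ℝ)

theorem shearScale_apply {σ : ℝ} (hσ : σ ≠ 0) (p : ℝ × ℝ) :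
    shearScale hσ p = (p.1, p.1 + σ * p.2) := rfl

theorem map_shearScale {σ : ℝ} (hσ : σ ≠ 0) :
    (volume : Measure (ℝ × ℝ)).map (shearScale hσ) = ENNReal.ofReal |σ⁻¹| • volume := by
  have h₁ : (volume : Measure (ℝ × ℝ)).map (Prod.map id (σ * ·)) =
      ENNReal.ofReal |σ⁻¹| • volume := by
    rw [Measure.volume_eq_prod, ← Measure.map_prod_map _ _ measurable_id (measurable_const_mul σ),
      Real.map_volume_mul_left hσ, Measure.map_id, Measure.prod_smul_right]
  have h₂ : ⇑(shearScale hσ) = (fun p : ℝ × ℝ => (p.1, p.1 + p.2)) ∘ Prod.map id (σ * ·) := rfl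
  rw [h₂, ← Measure.map_map (by fun_prop) (by fun_prop), h₁, Measure.map_smul]
  congr 1
  exact (measurePreserving_prod_add (volume : Measure ℝ) (volume : Measure ℝ)).map_eq

theorem integrable_comp_shearScale_iff {σ : ℝ} (hσ : σ ≠ 0) {f : ℝ × ℝ → ℝ} :
    Integrable (fun p : ℝ × ℝ => f (p.1, p.1 + σ * p.2)) ↔ Integrable f := by
  have := integrable_map_equiv (μ := (volume : Measure (ℝ × ℝ))) (shearScale hσ) f
  rw [map_shearScale, integrable_smul_measure (by simpa using hσ) ENNReal.ofReal_ne_top] at this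
  exact this.symm

theorem integral_comp_shearScale {σ : ℝ} (hσ : 0 < σ) (f : ℝ × ℝ → ℝ) :
    ∫ p : ℝ × ℝ, f p = ∫ p : ℝ × ℝ, σ * f (p.1, p.1 + σ * p.2) := by
  have := integral_map_equiv (μ := (volume : Measure (ℝ × ℝ))) (shearScale hσ.ne') f
  rw [map_shearScale, integral_smul_measure, ENNReal.toReal_ofReal (abs_nonneg _),
    abs_of_pos (inv_pos.2 hσ)] at this
  rw [integral_const_mul]
  simp only [shearScale_apply] at this
  rw [← this, smul_eq_mul, mul_inv_cancel_left₀ hσ.ne']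

end ChangeOfVariables

/-! ### Moment bounds uniform in n for the envelope and the perturbation -/

section UniformMoments

variable {Ω T : Type*} [MeasurableSpace Ω] [MeasurableSpace T] {P : Measure Ω} {μ : Measure T}

theorem ProbabilityTheory.HasGaussianLaw.integral_pow_two_mul {Y : Ω → ℝ}
    (hY : HasGaussianLaw Y P) (h₀ : ∫ ω, Y ω ∂P = 0) (j : ℕ) :
    ∫ ω, Y ω ^ (2 * j) ∂P = Var[Y; P] ^ j * ∫ x, x ^ (2 * j) ∂gaussianReal 0 1 := by
  have h₁ : P.map Y = (gaussianReal 0 1).map (√Var[Y; P] * ·) := by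
    rw [gaussianReal_map_const_mul, hY.map_eq_gaussianReal, h₀]
    congr 1
    · simp
    · ext
      simp [Real.sq_sqrt (variance_nonneg Y P), variance_nonneg Y P]
  have h₂ : ∫ ω, Y ω ^ (2 * j) ∂P = ∫ x, x ^ (2 * j) ∂(P.map Y) := by
    rw [integral_map hY.aemeasurable (by fun_prop)]
  rw [h₂, h₁, integral_map (by fun_prop) (by fun_prop), ← integral_const_mul]
  congr 1 with x
  rw [mul_pow, pow_mul (√_), Real.sq_sqrt (variance_nonneg Y P)]

variable {X K : T → Ω → ℝ} {w : T → ℝ}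

/-- An even moment of a centred Gaussian is a power of its variance times the standard moment, and
the variance is at most w². The bound therefore sees the field only through its weight. -/
theorem WeightedGaussianField.integral_pow_two_mul_le [IsProbabilityMeasure μ]
    (hF : WeightedGaussianField P X K w) (hw : ∀ N : ℕ, Integrable (fun t => w t ^ N) μ) (j : ℕ) :
    Integrable (fun p : Ω × T => X p.2 p.1 ^ (2 * j)) (P.prod μ) ∧
      ∫ p, X p.2 p.1 ^ (2 * j) ∂(P.prod μ) ≤
        (∫ x, x ^ (2 * j) ∂gaussianReal 0 1) * ∫ t, w t ^ (2 * j) ∂μ := by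
  have := hF.isProbabilityMeasure
  set c := ∫ x, x ^ (2 * j) ∂gaussianReal 0 1
  have hc : 0 ≤ c := integral_nonneg fun x => (even_two_mul j).pow_nonneg x
  have hE : ∀ t, ∫ ω, X t ω ^ (2 * j) ∂P = Var[X t; P] ^ j * c := fun t =>
    (hF.gaussian_left t).integral_pow_two_mul (hF.centred t) j
  have hle : ∀ t, Var[X t; P] ^ j * c ≤ c * w t ^ (2 * j) := fun t => by
    rw [mul_comm, pow_mul]
    have := variance_nonneg (X t) P
    have := hF.variance_le t
    gcongr
  have hi : Integrable (fun p : Ω × T => X p.2 p.1 ^ (2 * j)) (P.prod μ) := by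
    rw [integrable_prod_iff' (hF.measurable_left.pow_const _).aestronglyMeasurable]
    constructor
    · refine ae_of_all _ fun t => ?_
      have := ((hF.gaussian_left t).hasAllMoments.eval (.X ^ (2 * j))).integrable
      simpa using this
    · have : ∀ t, ∫ ω, ‖X t ω ^ (2 * j)‖ ∂P = Var[X t; P] ^ j * c := fun t => by
        rw [← hE]
        congr 1 with ω
        exact Real.norm_of_nonneg ((even_two_mul j).pow_nonneg _)
      simp only [this]
      refine ((hw (2 * j)).const_mul c).mono'
        ((hF.measurable_variance.pow_const j).mul_const c).aestronglyMeasurable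
        (ae_of_all _ fun t => ?_)
      rw [Real.norm_of_nonneg (mul_nonneg (pow_nonneg (variance_nonneg _ _) _) hc)]
      exact hle t
  refine ⟨hi, ?_⟩
  rw [integral_prod_symm _ hi]
  simp only [hE]
  rw [← integral_const_mul]
  exact integral_mono_of_nonneg (ae_of_all _ fun t =>
    mul_nonneg (pow_nonneg (variance_nonneg _ _) _) hc) ((hw (2 * j)).const_mul c) (ae_of_all _ hle)

theorem add_pow_le_two_pow_mul {a b : ℝ} (ha : 0 ≤ a) (hb : 0 ≤ b) (n : ℕ) :
    (a + b) ^ n ≤ 2 ^ n * (a ^ n + b ^ n) := by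
  refine (add_pow_le ha hb n).trans ?_
  gcongr
  · norm_num
  · omega

/-- The summand 1 covers negative k, where the exponential decreases in the exponent's coefficient.
-/
theorem exp_mul_le_one_add_exp_mul {p m : ℕ} (hpm : p ≤ m) (k : ℝ) :
    Real.exp (2 * p * k) ≤ 1 + Real.exp (2 * m * k) := by
  rcases le_total k 0 with h | h
  · have : Real.exp (2 * p * k) ≤ 1 := Real.exp_le_one_iff.2
      (mul_nonpos_of_nonneg_of_nonpos (by positivity) h)
    linarith [Real.exp_pos (2 * m * k)]
  · have : Real.exp (2 * p * k) ≤ Real.exp (2 * m * k) := by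
      gcongr
    linarith

/-- The moments of the envelope are bounded uniformly over all fields with the same weight. -/
theorem exists_integral_fieldEnvelope_pow_le [IsProbabilityMeasure μ] [IsProbabilityMeasure P]
    (hw : ∀ N : ℕ, Integrable (fun t => w t ^ N) μ) {p m : ℕ} (hpm : p ≤ m)
    (hK : Integrable (fun q : Ω × T => Real.exp (2 * m * K q.2 q.1)) (P.prod μ)) :
    ∃ C : ℝ, ∀ X : T → Ω → ℝ, WeightedGaussianField P X K w →
      Integrable (fun q : Ω × T => fieldEnvelope X K w q.2 q.1 ^ p) (P.prod μ) ∧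
      ∫ q, fieldEnvelope X K w q.2 q.1 ^ p ∂(P.prod μ) ≤ C := by
  -- Writing the envelope as y e^K, the constant comes from y^p e^{pK} ≤ y^{2p} + e^{2pK} and y ≤
  -- 3w³ + X⁴. It depends only on w, K and standard Gaussian moments, so it serves every field with
  -- that weight.
  refine ⟨2 ^ (2 * p) * (3 ^ (2 * p) * (∫ q, w q.2 ^ (6 * p) ∂(P.prod μ)) +
      (∫ x, x ^ (2 * (4 * p)) ∂gaussianReal 0 1) * ∫ t, w t ^ (2 * (4 * p)) ∂μ) +
      (1 + ∫ q, Real.exp (2 * m * K q.2 q.1) ∂(P.prod μ)), fun X hF => ?_⟩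
  obtain ⟨hXi, hXle⟩ := hF.integral_pow_two_mul_le hw (4 * p)
  have hwi : Integrable (fun q : Ω × T => w q.2 ^ (6 * p)) (P.prod μ) :=
    (hw (6 * p)).comp_snd P
  have hbound : ∀ q : Ω × T, fieldEnvelope X K w q.2 q.1 ^ p ≤
      2 ^ (2 * p) * (3 ^ (2 * p) * w q.2 ^ (6 * p) + X q.2 q.1 ^ (2 * (4 * p))) +
        (1 + Real.exp (2 * m * K q.2 q.1)) := by
    rintro ⟨ω, t⟩
    have h1 := hF.one_le_weight t
    simp only [fieldEnvelope]
    set y := w t * (1 + X t ω ^ 2 + w t ^ 2) with hy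
    have hy₀ : 0 ≤ y := by positivity
    have hy₁ : y ≤ 3 * w t ^ 3 + X t ω ^ 4 := by
      have : w t ^ 2 ≤ w t ^ 3 := pow_le_pow_right₀ h1 (by norm_num)
      have : w t ≤ w t ^ 3 := le_self_pow₀ h1 (by norm_num)
      nlinarith [sq_nonneg (w t - X t ω ^ 2), sq_nonneg (X t ω)]
    have hy₂ : y ^ (2 * p) ≤
        2 ^ (2 * p) * (3 ^ (2 * p) * w t ^ (6 * p) + X t ω ^ (2 * (4 * p))) := by
      calc y ^ (2 * p) ≤ (3 * w t ^ 3 + X t ω ^ 4) ^ (2 * p) := by gcongr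
        _ ≤ 2 ^ (2 * p) * ((3 * w t ^ 3) ^ (2 * p) + (X t ω ^ 4) ^ (2 * p)) :=
          add_pow_le_two_pow_mul (by positivity) (by positivity) _
        _ = _ := by
          rw [mul_pow, ← pow_mul, ← pow_mul]
          ring_nf
    have he : Real.exp (K t ω) ^ (2 * p) = Real.exp (2 * p * K t ω) := by
      rw [← Real.exp_nat_mul]
      push_cast
      rfl
    calc (y * Real.exp (K t ω)) ^ p
        = y ^ p * Real.exp (K t ω) ^ p := mul_pow _ _ _
      _ ≤ y ^ (2 * p) + Real.exp (K t ω) ^ (2 * p) := by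
          have e₁ : y ^ (2 * p) = (y ^ p) ^ 2 := by ring
          have e₂ : Real.exp (K t ω) ^ (2 * p) = (Real.exp (K t ω) ^ p) ^ 2 := by ring
          rw [e₁, e₂]
          nlinarith [sq_nonneg (y ^ p - Real.exp (K t ω) ^ p), sq_nonneg (y ^ p),
            sq_nonneg (Real.exp (K t ω) ^ p)]
      _ ≤ _ := by
          rw [he]
          exact add_le_add hy₂ (exp_mul_le_one_add_exp_mul hpm _)
  have i₁ := ((hwi.const_mul (3 ^ (2 * p))).fun_add hXi).const_mul (2 ^ (2 * p))
  have i₂ := (integrable_const (μ := P.prod μ) (1 : ℝ)).fun_add hK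
  have hGi := i₁.fun_add i₂
  refine ⟨hGi.mono' (hF.measurable_fieldEnvelope.pow_const p).aestronglyMeasurable
    (ae_of_all _ fun q => ?_), ?_⟩
  · rw [Real.norm_of_nonneg (pow_nonneg (hF.fieldEnvelope_nonneg _ _) _)]
    exact hbound q
  · refine (integral_mono_of_nonneg (ae_of_all _ fun q =>
      pow_nonneg (hF.fieldEnvelope_nonneg _ _) _) hGi (ae_of_all _ hbound)).trans ?_
    rw [integral_add i₁ i₂, integral_const_mul, integral_add (hwi.const_mul _) hXi,
      integral_const_mul, integral_add (integrable_const _) hK]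
    simp only [integral_const, probReal_univ, one_smul]
    gcongr

/-- One factor ε comes out of the difference; the rest is a product u v s, split by u v s ≤ u⁴ + v⁴
+ s². This is where the moment orders 8m for the field and its remainder, 4m for L − 1 and 2m for
the exponential come from. -/
theorem abs_perturbed_sq_sub_sq_mul_pow_le {ε x d l e : ℝ} (hε : 0 ≤ ε) (hε₁ : ε ≤ 1) (he : 0 ≤ e)
    (m : ℕ) :
    |((x + ε * d) ^ 2 * (1 + ε * l) - x ^ 2) * e| ^ m ≤
      ε ^ m * (2 ^ (8 * m) * (|x| ^ (8 * m) + |d| ^ (8 * m)) +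
        2 ^ (4 * m) * (|l| ^ (4 * m) + 1) + e ^ (2 * m)) := by
  set a := |x| + |d| with ha
  have ha₀ : 0 ≤ a := by positivity
  have h₁ : |(x + ε * d) ^ 2| ≤ a ^ 2 := by
    rw [abs_pow]
    gcongr
    refine (abs_add_le _ _).trans ?_
    rw [abs_mul, abs_of_nonneg hε, ha]
    gcongr
    exact mul_le_of_le_one_left (abs_nonneg d) hε₁
  have h₂ : |2 * x * d + ε * d ^ 2| ≤ a ^ 2 := by
    refine (abs_add_le _ _).trans ?_
    rw [abs_mul, abs_mul, abs_mul, abs_two, abs_of_nonneg hε, abs_of_nonneg (sq_nonneg d), ha]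
    nlinarith [sq_abs d, sq_abs x, mul_le_of_le_one_left (sq_nonneg d) hε₁, sq_nonneg x]
  have h₃ : |((x + ε * d) ^ 2 * (1 + ε * l) - x ^ 2) * e| ≤ ε * (a ^ 2 * (|l| + 1) * e) := by
    have e₁ : ((x + ε * d) ^ 2 * (1 + ε * l) - x ^ 2) * e =
        ε * (((x + ε * d) ^ 2 * l + (2 * x * d + ε * d ^ 2)) * e) := by ring
    rw [e₁, abs_mul, abs_mul, abs_of_nonneg hε, abs_of_nonneg he]
    gcongr
    refine (abs_add_le _ _).trans ?_
    rw [abs_mul, mul_add, mul_one]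
    gcongr
  refine (pow_le_pow_left₀ (abs_nonneg _) h₃ m).trans ?_
  rw [mul_pow]
  gcongr
  set u := a ^ (2 * m) with hu
  set v := (|l| + 1) ^ m with hv
  set s := e ^ m with hs
  have h₄ : (a ^ 2 * (|l| + 1) * e) ^ m = u * v * s := by
    rw [mul_pow, mul_pow, ← pow_mul]
  have hu₄ : u ^ 4 ≤ 2 ^ (8 * m) * (|x| ^ (8 * m) + |d| ^ (8 * m)) := by
    rw [hu, ← pow_mul, show 2 * m * 4 = 8 * m by ring]
    exact add_pow_le_two_pow_mul (abs_nonneg _) (abs_nonneg _) _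
  have hv₄ : v ^ 4 ≤ 2 ^ (4 * m) * (|l| ^ (4 * m) + 1) := by
    rw [hv, ← pow_mul, show m * 4 = 4 * m by ring]
    simpa using add_pow_le_two_pow_mul (abs_nonneg l) zero_le_one (4 * m)
  have hs₂ : s ^ 2 = e ^ (2 * m) := by rw [hs, ← pow_mul, mul_comm]
  rw [h₄, ← hs₂]
  nlinarith [sq_nonneg (u * v - s), sq_nonneg (u ^ 2 - v ^ 2), sq_nonneg (u * v), sq_nonneg s]

/-- The moments of the error made by replacing `(X + D)² L` by `X²` under the weight `exp K`. -/
theorem integral_perturbed_sq_pow_le {α : Type*} [MeasurableSpace α] {κ : Measure α}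
    [IsProbabilityMeasure κ] {X D L K : α → ℝ} (hX : Measurable X) (hD : Measurable D)
    (hL : Measurable L) (hK : Measurable K) {m : ℕ} {ε a b c k : ℝ} (hε : 0 < ε) (hε₁ : ε ≤ 1)
    (iX : Integrable (fun z => |X z| ^ (8 * m)) κ) (iD : Integrable (fun z => |D z| ^ (8 * m)) κ)
    (iL : Integrable (fun z => |L z - 1| ^ (4 * m)) κ)
    (iK : Integrable (fun z => Real.exp (2 * m * K z)) κ)
    (bX : ∫ z, |X z| ^ (8 * m) ∂κ ≤ a) (bD : ∫ z, |D z| ^ (8 * m) ∂κ ≤ b * ε ^ (8 * m))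
    (bL : ∫ z, |L z - 1| ^ (4 * m) ∂κ ≤ c * ε ^ (4 * m))
    (bK : ∫ z, Real.exp (2 * m * K z) ∂κ ≤ k) :
    Integrable (fun z => |((X z + D z) ^ 2 * L z - X z ^ 2) * Real.exp (K z)| ^ m) κ ∧
      ∫ z, |((X z + D z) ^ 2 * L z - X z ^ 2) * Real.exp (K z)| ^ m ∂κ ≤
        (2 ^ (8 * m) * (a + b) + 2 ^ (4 * m) * (c + 1) + k) * ε ^ m := by
  have hpt : ∀ z, |((X z + D z) ^ 2 * L z - X z ^ 2) * Real.exp (K z)| ^ m ≤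
      ε ^ m * (2 ^ (8 * m) * (|X z| ^ (8 * m) + |D z| ^ (8 * m) / ε ^ (8 * m)) +
        2 ^ (4 * m) * (|L z - 1| ^ (4 * m) / ε ^ (4 * m) + 1) + Real.exp (2 * m * K z)) := by
    intro z
    -- D and L − 1 have size ε in mean, so the quotients by ε have bounded moments.
    have := abs_perturbed_sq_sub_sq_mul_pow_le (x := X z) (d := D z / ε) (l := (L z - 1) / ε)
      hε.le hε₁ (Real.exp_pos (K z)).le m
    rw [mul_div_cancel₀ _ hε.ne', mul_div_cancel₀ _ hε.ne', add_sub_cancel, abs_div, abs_div,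
      abs_of_pos hε, div_pow, div_pow, ← Real.exp_nat_mul] at this
    exact_mod_cast this
  have i₁ := (iX.fun_add (iD.div_const (ε ^ (8 * m)))).const_mul (2 ^ (8 * m))
  have i₂ := ((iL.div_const (ε ^ (4 * m))).fun_add
    (integrable_const (μ := κ) (1 : ℝ))).const_mul (2 ^ (4 * m))
  have hG := ((i₁.fun_add i₂).fun_add iK).const_mul (ε ^ m)
  refine ⟨hG.mono' (by fun_prop) (ae_of_all _ fun z => ?_), ?_⟩
  · rw [Real.norm_of_nonneg (by positivity)]
    exact hpt z
  · refine (integral_mono_of_nonneg (ae_of_all _ fun z => by positivity) hG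
      (ae_of_all _ hpt)).trans ?_
    rw [integral_const_mul, integral_add (i₁.fun_add i₂) iK, mul_comm (ε ^ m)]
    rw [integral_add i₁ i₂, integral_const_mul, integral_const_mul, integral_add iX
      (iD.div_const _), integral_add (iL.div_const _) (integrable_const _), integral_div,
      integral_div]
    simp only [integral_const, probReal_univ, one_smul]
    have bD' : (∫ z, |D z| ^ (8 * m) ∂κ) / ε ^ (8 * m) ≤ b := by
      rwa [div_le_iff₀ (by positivity)]
    have bL' : (∫ z, |L z - 1| ^ (4 * m) ∂κ) / ε ^ (4 * m) ≤ c := by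
      rwa [div_le_iff₀ (by positivity)]
    gcongr

end UniformMoments

/-! ### The normalised fields and a common weight -/

section NormalisedField

theorem scale_pos {ℓ : ℝ} (hℓ : 0 < ℓ) (β : ℝ) {n : ℕ} (hn : 1 ≤ n) : 0 < scale ℓ β n := by
  have : (0 : ℝ) < n := by exact_mod_cast hn
  unfold scale
  positivity

theorem scale_rpow {ℓ : ℝ} (hℓ : 0 < ℓ) (β a : ℝ) (n : ℕ) :
    scale ℓ β n ^ a = ℓ ^ a * (n : ℝ) ^ (-(a / (2 * β))) := by
  have hn : (0 : ℝ) ≤ n := Nat.cast_nonneg n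
  rw [scale, Real.mul_rpow hℓ.le (Real.rpow_nonneg hn _), ← Real.rpow_mul hn]
  congr 2
  ring

theorem rpow_neg_natCast_le_one {a : ℝ} (ha : 0 ≤ a) {n : ℕ} (hn : 1 ≤ n) :
    (n : ℝ) ^ (-a) ≤ 1 :=
  Real.rpow_le_one_of_one_le_of_nonpos (by exact_mod_cast hn) (by linarith)

/-- The product of the measures with densities `ν₁` and `ν₂`. -/
noncomputable abbrev pointMeasure (ν₁ ν₂ : ℝ → ℝ) : Measure (ℝ × ℝ) :=
  (densityMeasure ν₁).prod (densityMeasure ν₂)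

variable {Ω : Type*} [MeasurableSpace Ω]

/-- The field `M_n` divided by `σ_n ^ β`. -/
noncomputable def normalisedField (ℓ β : ℝ) (M : ℕ → ℝ → ℝ → Ω → ℝ) (n : ℕ) (t : ℝ × ℝ) (ω : Ω) :
    ℝ :=
  (scale ℓ β n ^ β)⁻¹ * M n t.1 t.2 ω

/-- Bases at least one allow every covariance bound to be enlarged to a common constant and
exponent, and then written as a product of a weight at each point. -/
theorem le_weight_mul_weight {A A' a b c : ℝ} {N N' : ℕ} (ha : 1 ≤ a) (hb : 1 ≤ b) (hA : 1 ≤ A)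
    (hA' : A' ≤ A) (hN : N' ≤ N) (hc : c ≤ A' * (a * b) ^ N') :
    c ≤ A * a ^ N * (A * b ^ N) := by
  have hab : 1 ≤ a * b := one_le_mul_of_one_le_of_one_le ha hb
  calc c ≤ A' * (a * b) ^ N' := hc
    _ ≤ (A * A) * (a * b) ^ N := by
      gcongr
      nlinarith
    _ = _ := by rw [mul_pow]; ring

/-- The arithmetic mean is enough here: for weights at least one that dominate the variances, it
lies below the product of the weights. -/
theorem abs_covariance_le_half {P : Measure Ω} [IsProbabilityMeasure P] {Y Z : Ω → ℝ}
    (hY : MemLp Y 2 P) (hZ : MemLp Z 2 P) :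
    |cov[Y, Z; P]| ≤ (Var[Y; P] + Var[Z; P]) / 2 := by
  rw [← covariance_self hY.aemeasurable, ← covariance_self hZ.aemeasurable]
  simp only [covariance]
  have hY' := hY.sub (memLp_const (P[Y]))
  have hZ' := hZ.sub (memLp_const (P[Z]))
  have i₁ : Integrable (fun ω => (Y ω - P[Y]) * (Y ω - P[Y])) P := by
    simpa only [sq, Pi.sub_apply] using hY'.integrable_sq
  have i₂ : Integrable (fun ω => (Z ω - P[Z]) * (Z ω - P[Z])) P := by
    simpa only [sq, Pi.sub_apply] using hZ'.integrable_sq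
  rw [← integral_add i₁ i₂, ← integral_div]
  refine abs_integral_le_of_abs_le ((i₁.fun_add i₂).div_const 2) (ae_of_all _ fun ω => ?_)
  rw [abs_le]
  constructor <;>
    nlinarith [sq_nonneg ((Y ω - P[Y]) - (Z ω - P[Z])), sq_nonneg ((Y ω - P[Y]) + (Z ω - P[Z]))]

namespace AnomalousScalingFramework

variable {P : Measure Ω} {ν₁ ν₂ : ℝ → ℝ} {β γ ℓ : ℝ} {m : ℕ}
  {K : ℝ → Ω → ℝ} {q M : ℕ → ℝ → ℝ → Ω → ℝ} {h : ℝ → ℝ → ℝ}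
  (hF : AnomalousScalingFramework P ν₁ ν₂ β γ ℓ m K q M h)

include hF

theorem isProbabilityMeasure_pointMeasure : IsProbabilityMeasure (pointMeasure ν₁ ν₂) := by
  have := hF.density₁.isProbabilityMeasure
  have := hF.density₂.isProbabilityMeasure
  infer_instance

theorem hasGaussianLaw_M {n : ℕ} (hn : 1 ≤ n) (t : ℝ × ℝ) :
    HasGaussianLaw (M n t.1 t.2) P :=
  (hF.approx_normality.jointly_gaussian n hn).hasGaussianLaw_eval (.inr t)

theorem variance_normalisedField {n : ℕ} (hn : 1 ≤ n) (t : ℝ × ℝ) :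
    Var[normalisedField ℓ β M n t; P] = h t.1 t.2 := by
  have hs := scale_pos hF.ell_pos β hn
  have e : normalisedField ℓ β M n t = fun ω => (scale ℓ β n ^ β)⁻¹ * M n t.1 t.2 ω := rfl
  have e₂ : scale ℓ β n ^ (2 * β) = (scale ℓ β n ^ β) ^ 2 := by
    rw [← Real.rpow_natCast, ← Real.rpow_mul hs.le, mul_comm 2 β]
    norm_num
  have h₀ : scale ℓ β n ^ β ≠ 0 := (Real.rpow_pos_of_pos hs β).ne'
  rw [e, variance_const_mul, hF.approx_normality.variance_eq n hn, e₂]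
  field_simp

theorem covariance_normalisedField [IsProbabilityMeasure P] {n : ℕ} (hn : 1 ≤ n) (t : ℝ × ℝ)
    {Y : Ω → ℝ}
    (hY : HasGaussianLaw Y P) :
    cov[normalisedField ℓ β M n t, Y; P] =
      (scale ℓ β n ^ β)⁻¹ * ∫ ω, M n t.1 t.2 ω * Y ω ∂P := by
  have e : normalisedField ℓ β M n t = fun ω => (scale ℓ β n ^ β)⁻¹ * M n t.1 t.2 ω := rfl
  rw [e, covariance_const_mul_left, covariance_eq_sub (hF.hasGaussianLaw_M hn t).memLp_two
    hY.memLp_two, hF.approx_normality.centred n hn, zero_mul, sub_zero]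
  rfl

theorem isGaussianProcess_normalisedField {n : ℕ} (hn : 1 ≤ n) :
    IsGaussianProcess (Sum.elim (normalisedField ℓ β M n) fun t : ℝ × ℝ => K t.1) P := by
  have e : (Sum.elim (normalisedField ℓ β M n) fun t : ℝ × ℝ => K t.1) =
      fun i ω => (Sum.elim (fun _ => (scale ℓ β n ^ β)⁻¹) (fun _ => 1) i : ℝ) •
        (Sum.elim K (fun p : ℝ × ℝ => M n p.1 p.2) ∘
          Sum.elim (fun t : ℝ × ℝ => Sum.inr t) (fun t : ℝ × ℝ => Sum.inl t.1)) i ω := by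
    funext i ω
    rcases i with i | i <;> simp [normalisedField]
  rw [e]
  exact ((hF.approx_normality.jointly_gaussian n hn).comp_right _).smul _

/-- A weight of polynomial growth controlling all the normalised fields. -/
theorem exists_weight [IsProbabilityMeasure P] :
    ∃ (w : ℝ × ℝ → ℝ) (C : ℝ), 0 ≤ C ∧
      (∀ N : ℕ, Integrable (fun t => w t ^ N) (pointMeasure ν₁ ν₂)) ∧
      ∀ n : ℕ, 1 ≤ n →
        WeightedGaussianField P (normalisedField ℓ β M n) (fun t => K t.1) w ∧
        (∀ s t : ℝ × ℝ, |cov[normalisedField ℓ β M n s, K t.1; P]| ≤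
          (n : ℝ) ^ (-(γ / (2 * β))) * (w s * w t)) ∧
        ∃ S : Set ((ℝ × ℝ) × (ℝ × ℝ)), MeasurableSet S ∧
          (∀ s t, (s, t) ∈ S →
            |cov[normalisedField ℓ β M n s, normalisedField ℓ β M n t; P]| ≤
              (n : ℝ) ^ (-(γ / (2 * β))) * (w s * w t)) ∧
          ((pointMeasure ν₁ ν₂).prod (pointMeasure ν₁ ν₂)).real Sᶜ ≤
            C * (n : ℝ) ^ (-(1 / (4 * β))) := by
  obtain ⟨S, g₁, g₂, hSm, ⟨C, hC, hSle⟩, hS₁, hS₂⟩ := hF.weak_dependence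
  obtain ⟨C₀, N₀, hh⟩ := hF.approx_normality.poly_growth
  obtain ⟨A₁, N₁, hA₁, hg₁⟩ := g₁.exists_abs_eval_le
  obtain ⟨A₂, N₂, hA₂, hg₂⟩ := g₂.exists_abs_eval_le
  have hβ := hF.beta_pos
  have hγ := hF.gamma_pos
  have hℓ := hF.ell_pos
  have hℓγ : 0 < ℓ ^ γ := Real.rpow_pos_of_pos hℓ γ
  -- A sum in place of a maximum: A is at least one and dominates each constant. The factors ℓ^γ
  -- appear because σ^γ = ℓ^γ ε.
  set A := 1 + |C₀| + A₁ * ℓ ^ γ + A₂ * ℓ ^ γ with hA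
  set N := N₀ + N₁ + N₂ with hN
  have hA1 : 1 ≤ A := by
    have := abs_nonneg C₀
    have := mul_nonneg hA₁ hℓγ.le
    have := mul_nonneg hA₂ hℓγ.le
    linarith
  let b : ℝ × ℝ → ℝ := fun t => 1 + |t.1| + |t.2|
  have hb : ∀ t, 1 ≤ b t := fun t => by
    have := abs_nonneg t.1
    have := abs_nonneg t.2
    simp only [b]
    linarith
  have hbb₁ : ∀ s t : ℝ × ℝ, 1 + (|s.1| + |s.2| + |t.1| + |t.2|) ≤ b s * b t := fun s t => by
    have := mul_nonneg (add_nonneg (abs_nonneg s.1) (abs_nonneg s.2))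
      (add_nonneg (abs_nonneg t.1) (abs_nonneg t.2))
    simp only [b]
    nlinarith
  have hbb₂ : ∀ s t : ℝ × ℝ, 1 + (|s.1| + |s.2| + |t.1|) ≤ b s * b t := fun s t => by
    have := hbb₁ s t
    have := abs_nonneg t.2
    linarith
  refine ⟨fun t => A * b t ^ N, C * ℓ ^ (1 / 2 : ℝ), by positivity, fun k => ?_, fun n hn => ?_⟩
  · simp only [mul_pow, ← pow_mul]
    exact (hF.density₁.integrable_one_add_abs_add_abs_pow hF.density₂ _).const_mul _
  have hs := scale_pos hℓ β hn
  set σ := scale ℓ β n with hσ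
  have hσβ : 0 < σ ^ β := Real.rpow_pos_of_pos hs β
  set ε := (n : ℝ) ^ (-(γ / (2 * β))) with hε
  have hε₀ : 0 ≤ ε := by positivity
  have hε₁ : ε ≤ 1 := rpow_neg_natCast_le_one (by positivity) hn
  have hσγ : σ ^ γ = ℓ ^ γ * ε := scale_rpow hℓ β γ n
  have gK : ∀ x, HasGaussianLaw (K x) P := fun x => hF.perturbation.gaussian.hasGaussianLaw_eval x
  have gP := hF.isGaussianProcess_normalisedField hn
  have gX : ∀ t, HasGaussianLaw (normalisedField ℓ β M n t) P :=
    fun t => gP.hasGaussianLaw_eval (.inl t)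
  have hc : ∀ s t : ℝ × ℝ, |cov[normalisedField ℓ β M n s, K t.1; P]| ≤
      ε * (A * b s ^ N * (A * b t ^ N)) := by
    intro s t
    rw [hF.covariance_normalisedField hn s (gK t.1), abs_mul, abs_of_pos (inv_pos.2 hσβ)]
    have h₁ := hS₂ n hn s.1 s.2 t.1
    have h₂ := (le_abs_self _).trans (hg₂ ![s.1, s.2, t.1])
    simp only [Fin.sum_univ_three] at h₂
    have h₃ : A₂ * ℓ ^ γ * (1 + (|s.1| + |s.2| + |t.1|)) ^ N₂ ≤
        A * b s ^ N * (A * b t ^ N) := by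
      refine le_weight_mul_weight (A' := A₂ * ℓ ^ γ) (N' := N₂) (hb s) (hb t) hA1 ?_ (by omega) ?_
      · have := abs_nonneg C₀
        have := mul_nonneg hA₁ hℓγ.le
        linarith
      · gcongr
        exact hbb₂ s t
    calc (σ ^ β)⁻¹ * |∫ ω, M n s.1 s.2 ω * K t.1 ω ∂P|
        ≤ (σ ^ β)⁻¹ * ((A₂ * (1 + (|s.1| + |s.2| + |t.1|)) ^ N₂) * σ ^ (β + γ)) := by
          gcongr
          exact h₁.trans (mul_le_mul_of_nonneg_right h₂ (Real.rpow_nonneg hs.le _))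
      _ = ε * (A₂ * ℓ ^ γ * (1 + (|s.1| + |s.2| + |t.1|)) ^ N₂) := by
          rw [Real.rpow_add hs, hσγ]
          field_simp
      _ ≤ _ := by gcongr
  have hVar : ∀ t, Var[normalisedField ℓ β M n t; P] ≤ A * b t ^ N := by
    intro t
    rw [hF.variance_normalisedField hn]
    refine (le_abs_self _).trans ((hh t.1 t.2).trans ?_)
    calc C₀ * (1 + |t.1| + |t.2|) ^ N₀ ≤ A * b t ^ N₀ := by
          change C₀ * b t ^ N₀ ≤ _
          have := zero_le_one.trans (hb t)
          gcongr
          have := le_abs_self C₀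
          have := mul_nonneg hA₁ hℓγ.le
          have := mul_nonneg hA₂ hℓγ.le
          linarith
      _ ≤ A * b t ^ N := by
          have := zero_le_one.trans hA1
          gcongr
          · exact hb t
          · omega
  have hw1 : ∀ t, 1 ≤ A * b t ^ N := fun t =>
    one_le_mul_of_one_le_of_one_le hA1 (one_le_pow₀ (hb t))
  refine ⟨⟨?_, ?_, gP, fun t => ?_, by fun_prop, hw1, fun s t => ?_, fun s t => ?_⟩, hc,
    S n, hSm n hn, fun s t hst => ?_, ?_⟩
  · exact ((hF.approx_normality.measurable n hn).comp (by fun_prop :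
      Measurable fun p : Ω × ℝ × ℝ => (p.2.1, p.2.2, p.1))).const_mul _
  · exact hF.perturbation.measurable.comp (by fun_prop :
      Measurable fun p : Ω × ℝ × ℝ => (p.2.1, p.1))
  · simp only [normalisedField]
    rw [integral_const_mul, hF.approx_normality.centred n hn, mul_zero]
  · refine (abs_covariance_le_half (gX s).memLp_two (gX t).memLp_two).trans ?_
    have := hVar s
    have := hVar t
    nlinarith [hw1 s, hw1 t]
  · refine (hc s t).trans (mul_le_of_le_one_left ?_ hε₁)
    exact mul_nonneg (zero_le_one.trans (hw1 s)) (zero_le_one.trans (hw1 t))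
  · have e : ∫ ω, M n s.1 s.2 ω * normalisedField ℓ β M n t ω ∂P =
        (σ ^ β)⁻¹ * ∫ ω, M n s.1 s.2 ω * M n t.1 t.2 ω ∂P := by
      rw [← integral_const_mul]
      congr 1 with ω
      simp only [normalisedField]
      ring
    rw [hF.covariance_normalisedField hn s (gX t), e, abs_mul, abs_mul,
      abs_of_pos (inv_pos.2 hσβ)]
    have h₁ := hS₁ n hn s.1 s.2 t.1 t.2 hst
    have h₂ := (le_abs_self _).trans (hg₁ ![s.1, s.2, t.1, t.2])
    simp only [Fin.sum_univ_four] at h₂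
    have h₃ : A₁ * ℓ ^ γ * (1 + (|s.1| + |s.2| + |t.1| + |t.2|)) ^ N₁ ≤
        A * b s ^ N * (A * b t ^ N) := by
      refine le_weight_mul_weight (A' := A₁ * ℓ ^ γ) (N' := N₁) (hb s) (hb t) hA1 ?_ (by omega) ?_
      · have := abs_nonneg C₀
        have := mul_nonneg hA₂ hℓγ.le
        linarith
      · gcongr
        exact hbb₁ s t
    calc (σ ^ β)⁻¹ * ((σ ^ β)⁻¹ * |∫ ω, M n s.1 s.2 ω * M n t.1 t.2 ω ∂P|)
        ≤ (σ ^ β)⁻¹ * ((σ ^ β)⁻¹ *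
            ((A₁ * (1 + (|s.1| + |s.2| + |t.1| + |t.2|)) ^ N₁) * σ ^ (2 * β + γ))) := by
          gcongr
          exact h₁.trans (mul_le_mul_of_nonneg_right h₂ (Real.rpow_nonneg hs.le _))
      _ = ε * (A₁ * ℓ ^ γ * (1 + (|s.1| + |s.2| + |t.1| + |t.2|)) ^ N₁) := by
          rw [two_mul, Real.rpow_add hs, Real.rpow_add hs, hσγ]
          field_simp
      _ ≤ _ := by gcongr
  · have h₁ := hSle n hn
    beta_reduce at h₁
    rw [← hF.density₁.prod_prod_apply hF.density₂ (hSm n hn).compl] at h₁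
    have h₂ : C * σ ^ (1 / 2 : ℝ) = C * ℓ ^ (1 / 2 : ℝ) * (n : ℝ) ^ (-(1 / (4 * β))) := by
      rw [hσ, scale_rpow hℓ, mul_assoc]
      congr 3
      field_simp
      norm_num
    rw [← h₂]
    exact ENNReal.toReal_le_of_le_ofReal (by positivity) h₁

end AnomalousScalingFramework

end NormalisedField

/-! ### Both errors vanish almost surely -/

section ScalingFramework

variable {Ω : Type*} [MeasurableSpace Ω] {P : Measure Ω} {ν₁ ν₂ : ℝ → ℝ} {β γ ℓ : ℝ} {m : ℕ}
  {K : ℝ → Ω → ℝ} {q M : ℕ → ℝ → ℝ → Ω → ℝ} {h : ℝ → ℝ → ℝ}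

/-- The assumptions are phrased as iterated lower integrals against Lebesgue densities; Tonelli
turns them into Bochner integrals on the product space. -/
theorem IsDensityWithMoments.integrable_of_lintegral_le [SFinite P]
    (h₁ : IsDensityWithMoments ν₁) (h₂ : IsDensityWithMoments ν₂) {G : Ω × (ℝ × ℝ) → ℝ}
    (hG : Measurable G) (hG₀ : ∀ z, 0 ≤ G z) {c : ℝ} (hc : 0 ≤ c)
    (hle : ∫⁻ p : ℝ × ℝ, (∫⁻ ω, ENNReal.ofReal (G (ω, p)) ∂P) *
      ENNReal.ofReal (ν₁ p.1 * ν₂ p.2) ≤ ENNReal.ofReal c) :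
    Integrable G (P.prod (pointMeasure ν₁ ν₂)) ∧
      ∫ z, G z ∂(P.prod (pointMeasure ν₁ ν₂)) ≤ c := by
  have := h₁.isProbabilityMeasure
  have := h₂.isProbabilityMeasure
  have e : ∫⁻ z, ENNReal.ofReal (G z) ∂(P.prod (pointMeasure ν₁ ν₂)) ≤ ENNReal.ofReal c := by
    rw [lintegral_prod_symm _ hG.ennreal_ofReal.aemeasurable,
      h₁.lintegral_prod_eq h₂ hG.ennreal_ofReal.lintegral_prod_left']
    exact hle
  constructor
  · refine ⟨hG.aestronglyMeasurable, ?_⟩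
    rw [hasFiniteIntegral_iff_ofReal (ae_of_all _ hG₀)]
    exact e.trans_lt ENNReal.ofReal_lt_top
  · rw [integral_eq_lintegral_of_nonneg_ae (ae_of_all _ hG₀) hG.aestronglyMeasurable]
    exact ENNReal.toReal_le_of_le_ofReal hc e

/-- Jensen in the space variable bounds the m-th moment of the spatial average by the joint m-th
moment, which is summable in n. -/
theorem ae_tendsto_integral_of_integral_pow_le {T : Type*} [MeasurableSpace T] {μ : Measure T}
    [IsProbabilityMeasure P] [IsProbabilityMeasure μ] {E : ℕ → Ω → T → ℝ}
    (hmeas : ∀ n, 1 ≤ n → Measurable fun z : Ω × T => E n z.1 z.2) {m : ℕ} (hm : 1 ≤ m) {C s : ℝ}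
    (hs : 1 < s)
    (hmom : ∀ n : ℕ, 1 ≤ n → Integrable (fun z : Ω × T => |E n z.1 z.2| ^ m) (P.prod μ) ∧
      ∫ z, |E n z.1 z.2| ^ m ∂(P.prod μ) ≤ C * (n : ℝ) ^ (-s)) :
    ∀ᵐ ω ∂P, (∀ n : ℕ, 1 ≤ n → Integrable (E n ω) μ) ∧
      Tendsto (fun n => ∫ t, E n ω t ∂μ) atTop (𝓝 0) := by
  have hae : ∀ᵐ ω ∂P, ∀ n : ℕ, 1 ≤ n →
      Integrable (fun t => |E n ω t| ^ m) μ := by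
    rw [ae_all_iff]
    intro n
    by_cases hn : 1 ≤ n
    · filter_upwards [(hmom n hn).1.prod_right_ae] with ω hω _ using hω
    · exact ae_of_all _ fun ω h => absurd h hn
  have hmω : ∀ n, 1 ≤ n → ∀ ω, Measurable (E n ω) :=
    fun n hn ω => (hmeas n hn).comp (measurable_const.prodMk measurable_id)
  have habs : ∀ n, 1 ≤ n → ∀ ω,
      Integrable (fun t => |E n ω t| ^ m) μ →
      Integrable (E n ω) μ := by
    intro n hn ω hω
    have := Integrable.pow_of_pow_le (f := fun t => |E n ω t|)
      (_root_.continuous_abs.measurable.comp (hmω n hn ω)).aestronglyMeasurable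
      (fun t => abs_nonneg _) hm hω
    simp only [pow_one] at this
    exact (integrable_norm_iff (hmω n hn ω).aestronglyMeasurable).1 this
  have hpow : ∀ n, 1 ≤ n → ∀ ω,
      Integrable (fun t => |E n ω t| ^ m) μ →
      |∫ t, E n ω t ∂μ| ^ m ≤
        ∫ t, |E n ω t| ^ m ∂μ := by
    intro n hn ω hω
    refine (pow_le_pow_left₀ (abs_nonneg _) (abs_integral_le_integral_abs) m).trans ?_
    exact pow_integral_le_integral_pow
      (_root_.continuous_abs.measurable.comp (hmω n hn ω)).aestronglyMeasurable
      (fun t => abs_nonneg _) m hω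
  have htend := ae_tendsto_zero_of_integral_pow_le (P := P)
    (f := fun n ω => ∫ t, E n ω t ∂μ)
    (p := m) (by omega) (C := C) hs
    (fun n hn => by
      refine (hmom n hn).1.integral_prod_left.mono' ?_ ?_
      · exact ((_root_.continuous_abs.measurable.comp
          ((hmeas n hn).stronglyMeasurable.integral_prod_right'
            (ν := μ)).measurable).pow_const m).aestronglyMeasurable
      · filter_upwards [hae] with ω hω
        rw [Real.norm_of_nonneg (by positivity)]
        exact hpow n hn ω (hω n hn))
    (fun n hn => by
      refine le_trans ?_ (hmom n hn).2
      rw [integral_prod _ (hmom n hn).1]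
      refine integral_mono_of_nonneg (ae_of_all _ fun ω => by positivity)
        (hmom n hn).1.integral_prod_left ?_
      filter_upwards [hae] with ω hω
      exact hpow n hn ω (hω n hn))
  filter_upwards [hae, htend] with ω hω hω'
  exact ⟨fun n hn => habs n hn ω (hω n hn), hω'⟩

/-- The limiting integrand is replaced by the actual one at the cost of this error. -/
noncomputable def perturbationError (ℓ β : ℝ) (K : ℝ → Ω → ℝ) (M L Δ : ℕ → ℝ → ℝ → Ω → ℝ) (n : ℕ)
    (ω : Ω) (t : ℝ × ℝ) : ℝ :=
  ((normalisedField ℓ β M n t ω + normalisedField ℓ β Δ n t ω) ^ 2 * L n t.1 t.2 ω -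
    normalisedField ℓ β M n t ω ^ 2) * Real.exp (K t.1 ω)

namespace AnomalousScalingFramework

/-- Let r = (m−1)/2, rounded down. The moment 2r is even, as the absorption argument requires, and
at most m, as the envelope requires. From m ≤ 2r + 2 one gets r > 72β/min(24γ, 1), so the three
exponents exceed 3/2, 9 and 3: the assumption on m leaves room. -/
theorem one_lt_exponents (hβ : 0 < β) (hγ : 0 < γ) (hm : 3 + 144 * β / min (24 * γ) 1 < (m : ℝ)) :
    1 ≤ (m - 1) / 2 ∧ 2 * ((m - 1) / 2) ≤ m ∧ 1 < γ / (2 * β) * (((m - 1) / 2 : ℕ) : ℝ) ∧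
      1 < 1 / (8 * β) * (((m - 1) / 2 : ℕ) : ℝ) ∧ 1 < γ / (2 * β) * m := by
  set k := min (24 * γ) 1 with hk
  have hk₀ : 0 < k := lt_min (by positivity) one_pos
  have hk₁ : k ≤ 24 * γ := min_le_left _ _
  have hk₂ : k ≤ 1 := min_le_right _ _
  set y := 144 * β / k with hy
  have hyk : y * k = 144 * β := div_mul_cancel₀ _ hk₀.ne'
  have hy₀ : 0 < y := by positivity
  have hy₁ : 6 * β ≤ y * γ := by nlinarith
  have hy₂ : 144 * β ≤ y := by nlinarith
  have hm4 : 4 ≤ m := by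
    have : (3 : ℝ) < m := by linarith
    exact_mod_cast this
  set r := (m - 1) / 2 with hr
  have hr₁ : m ≤ 2 * r + 2 := by omega
  have hr₂ : (m : ℝ) ≤ 2 * r + 2 := by exact_mod_cast hr₁
  have hr₃ : y / 2 < r := by linarith
  refine ⟨by omega, by omega, ?_, ?_, ?_⟩
  · rw [div_mul_eq_mul_div, lt_div_iff₀ (by positivity)]
    nlinarith
  · rw [div_mul_eq_mul_div, lt_div_iff₀ (by positivity)]
    nlinarith
  · rw [div_mul_eq_mul_div, lt_div_iff₀ (by positivity)]
    nlinarith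

variable (hF : AnomalousScalingFramework P ν₁ ν₂ β γ ℓ m K q M h)

include hF

theorem measurable_field :
    Measurable fun z : Ω × (ℝ × ℝ) => K z.2.1 z.1 :=
  hF.perturbation.measurable.comp (by fun_prop :
    Measurable fun p : Ω × ℝ × ℝ => (p.2.1, p.1))

theorem integral_exp_field (x : ℝ) (s : ℝ) :
    ∫ ω, Real.exp (s * K x ω) ∂P = Real.exp (s ^ 2 * Var[K x; P] / 2) := by
  have g : HasGaussianLaw (K x) P := hF.perturbation.gaussian.hasGaussianLaw_eval x
  have := mgf_gaussianReal g.map_eq_gaussianReal s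
  rw [mgf, hF.perturbation.centred, Real.coe_toNNReal _ (variance_nonneg _ _)] at this
  rw [this]
  congr 1
  ring

/-- With s = 2m the Gaussian exponent s²k/2 equals 2m²k, exactly the one assumed integrable against
ν₁. -/
theorem integrable_exp_field [IsProbabilityMeasure P] :
    Integrable (fun z : Ω × (ℝ × ℝ) => Real.exp (2 * m * K z.2.1 z.1))
      (P.prod (pointMeasure ν₁ ν₂)) := by
  have := hF.density₁.isProbabilityMeasure
  have := hF.density₂.isProbabilityMeasure
  have hm : Measurable fun z : Ω × (ℝ × ℝ) => Real.exp (2 * m * K z.2.1 z.1) :=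
    (hF.measurable_field.const_mul _).exp
  rw [integrable_prod_iff' hm.aestronglyMeasurable]
  constructor
  · exact ae_of_all _ fun t =>
      (hF.perturbation.gaussian.hasGaussianLaw_eval t.1).integrable_exp_mul _
  · simp only [Real.norm_eq_abs, Real.abs_exp, hF.integral_exp_field]
    have h₁ := (hF.density₁.integrable_densityMeasure_iff).2 hF.perturbation.exp_moment
    refine (h₁.comp_fst (densityMeasure ν₂)).congr (ae_of_all _ fun t => ?_)
    simp only
    congr 1
    ring

theorem ae_tendsto_avgExpCentredSq [IsProbabilityMeasure P] :
    ∀ᵐ ω ∂P, Tendsto (fun n => avgExpCentredSq P (pointMeasure ν₁ ν₂)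
      (normalisedField ℓ β M n) (fun t => K t.1) ω) atTop (𝓝 0) := by
  have := hF.isProbabilityMeasure_pointMeasure
  obtain ⟨hr₁, hrm, hs₁, hs₂, -⟩ := one_lt_exponents hF.beta_pos hF.gamma_pos hF.m_large
  set r := (m - 1) / 2
  obtain ⟨w, C, hC, hw, hfield⟩ := hF.exists_weight
  obtain ⟨C', hC'⟩ := exists_integral_fieldEnvelope_pow_le (K := fun t : ℝ × ℝ => K t.1)
    hw hrm hF.integrable_exp_field
  have hβ := hF.beta_pos
  have hγ := hF.gamma_pos
  -- The slower of two rates: ε = n^{-γ/(2β)}, and √δ, which is of order n^{-1/(8β)} because δ is of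
  -- order σ^{1/2}, hence n^{-1/(4β)}.
  set a := min (γ / (2 * β)) (1 / (8 * β)) with ha
  have hs : 1 < a * r := by
    rcases min_choice (γ / (2 * β)) (1 / (8 * β)) with h | h <;> rw [ha, h] <;> assumption
  have hmom : ∀ n : ℕ, 1 ≤ n →
      Integrable (fun ω => |avgExpCentredSq P (pointMeasure ν₁ ν₂)
        (normalisedField ℓ β M n) (fun t => K t.1) ω| ^ (2 * r)) P ∧
      ∫ ω, |avgExpCentredSq P (pointMeasure ν₁ ν₂)
        (normalisedField ℓ β M n) (fun t => K t.1) ω| ^ (2 * r) ∂P ≤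
        2 * (16 ^ r + (16 * r) ^ r) * (1 + √C) ^ r * C' * (n : ℝ) ^ (-(a * r)) := by
    intro n hn
    obtain ⟨hWG, hc, S, hS, hr, hδ⟩ := hfield n hn
    obtain ⟨hBi, hBle⟩ := hC' _ hWG
    obtain ⟨hi, hle⟩ := hWG.integral_avg_pow_le hr₁ (by positivity)
      (rpow_neg_natCast_le_one (by positivity) hn) hS hc hr hBi
    simp only [(even_two_mul r).pow_abs]
    refine ⟨hi, hle.trans ?_⟩
    have hn₁ : (1 : ℝ) ≤ n := by exact_mod_cast hn
    have hn₀ : (0 : ℝ) ≤ n := by linarith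
    have b₁ : (n : ℝ) ^ (-(γ / (2 * β))) ≤ (n : ℝ) ^ (-a) :=
      Real.rpow_le_rpow_of_exponent_le hn₁ (neg_le_neg (min_le_left _ _))
    have b₂ : √(((pointMeasure ν₁ ν₂).prod (pointMeasure ν₁ ν₂)).real Sᶜ) ≤
        √C * (n : ℝ) ^ (-a) := by
      refine (Real.sqrt_le_sqrt hδ).trans ?_
      rw [Real.sqrt_mul hC, Real.sqrt_eq_rpow ((n : ℝ) ^ _), ← Real.rpow_mul hn₀]
      gcongr ?_ * ?_
      refine Real.rpow_le_rpow_of_exponent_le hn₁ ?_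
      · have := min_le_right (γ / (2 * β)) (1 / (8 * β))
        have e : -(1 / (4 * β)) * (1 / 2) = -(1 / (8 * β)) := by
          field_simp
          norm_num
        rw [e]
        exact neg_le_neg this
    have b₃ : ((n : ℝ) ^ (-(γ / (2 * β))) +
        √(((pointMeasure ν₁ ν₂).prod (pointMeasure ν₁ ν₂)).real Sᶜ)) ^ r ≤
        (1 + √C) ^ r * (n : ℝ) ^ (-(a * r)) := by
      have e : (n : ℝ) ^ (-(a * r)) = ((n : ℝ) ^ (-a)) ^ r := by
        rw [← Real.rpow_natCast, ← Real.rpow_mul hn₀, neg_mul]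
      rw [e, ← mul_pow]
      gcongr
      linarith
    have hB₀ : 0 ≤ ∫ p, fieldEnvelope (normalisedField ℓ β M n) (fun t => K t.1) w p.2 p.1 ^ (2 * r)
        ∂(P.prod (pointMeasure ν₁ ν₂)) :=
      integral_nonneg fun p => pow_nonneg (hWG.fieldEnvelope_nonneg _ _) _
    calc _ ≤ 2 * (16 ^ r + (16 * r) ^ r) * ((1 + √C) ^ r * (n : ℝ) ^ (-(a * r))) * C' := by
          gcongr
      _ = _ := by ring
  exact ae_tendsto_zero_of_integral_pow_le (by omega) hs (fun n hn => (hmom n hn).1)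
    fun n hn => (hmom n hn).2

theorem measurable_perturbationError {L Δ : ℕ → ℝ → ℝ → Ω → ℝ} {n : ℕ} (hn : 1 ≤ n)
    (hLm : Measurable (fun t : ℝ × ℝ × Ω => L n t.1 t.2.1 t.2.2))
    (hΔm : Measurable (fun t : ℝ × ℝ × Ω => Δ n t.1 t.2.1 t.2.2)) :
    Measurable fun z : Ω × (ℝ × ℝ) => perturbationError ℓ β K M L Δ n z.1 z.2 := by
  have mt : Measurable fun p : Ω × ℝ × ℝ => (p.2.1, p.2.2, p.1) := by fun_prop
  have mM := (hF.approx_normality.measurable n hn).comp mt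
  have mΔ := hΔm.comp mt
  have mL := hLm.comp mt
  exact (((((mM.const_mul _).add (mΔ.const_mul _)).pow_const 2).mul mL).sub
    ((mM.const_mul _).pow_const 2)).mul hF.measurable_field.exp

theorem exists_integral_perturbationError_pow_le [IsProbabilityMeasure P] {L Δ : ℕ → ℝ → ℝ → Ω → ℝ}
    (hLm : ∀ n : ℕ, 1 ≤ n → Measurable (fun t : ℝ × ℝ × Ω => L n t.1 t.2.1 t.2.2))
    (hL : Precsim
      (fun n => ∫⁻ p : ℝ × ℝ, (∫⁻ ω, ENNReal.ofReal (|L n p.1 p.2 ω - 1| ^ (4 * m)) ∂P) *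
        ENNReal.ofReal (ν₁ p.1 * ν₂ p.2))
      (fun n => scale ℓ β n ^ (4 * (m : ℝ) * γ)))
    (hΔm : ∀ n : ℕ, 1 ≤ n → Measurable (fun t : ℝ × ℝ × Ω => Δ n t.1 t.2.1 t.2.2))
    (hΔ : Precsim
      (fun n => ∫⁻ p : ℝ × ℝ, (∫⁻ ω, ENNReal.ofReal (|Δ n p.1 p.2 ω| ^ (8 * m)) ∂P) *
        ENNReal.ofReal (ν₁ p.1 * ν₂ p.2))
      (fun n => scale ℓ β n ^ (8 * (m : ℝ) * β + 8 * (m : ℝ) * γ))) :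
    ∃ C : ℝ, ∀ n : ℕ, 1 ≤ n →
      Integrable (fun z : Ω × (ℝ × ℝ) => |perturbationError ℓ β K M L Δ n z.1 z.2| ^ m)
        (P.prod (pointMeasure ν₁ ν₂)) ∧
      ∫ z, |perturbationError ℓ β K M L Δ n z.1 z.2| ^ m ∂(P.prod (pointMeasure ν₁ ν₂)) ≤
        C * (n : ℝ) ^ (-(γ / (2 * β) * m)) := by
  have := hF.isProbabilityMeasure_pointMeasure
  have hβ := hF.beta_pos
  have hγ := hF.gamma_pos
  have hℓ := hF.ell_pos
  obtain ⟨w, _, _, hw, hfield⟩ := hF.exists_weight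
  obtain ⟨CL, hCL, hLle⟩ := hL
  obtain ⟨CΔ, hCΔ, hΔle⟩ := hΔ
  have mt : Measurable fun p : Ω × ℝ × ℝ => (p.2.1, p.2.2, p.1) := by fun_prop
  set A := (∫ x, x ^ (2 * (4 * m)) ∂gaussianReal 0 1) *
    ∫ t, w t ^ (2 * (4 * m)) ∂(pointMeasure ν₁ ν₂)
  set Ck := ∫ z : Ω × (ℝ × ℝ), Real.exp (2 * m * K z.2.1 z.1) ∂(P.prod (pointMeasure ν₁ ν₂))
  refine ⟨2 ^ (8 * m) * (A + CΔ * (ℓ ^ γ) ^ (8 * m)) +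
    2 ^ (4 * m) * (CL * (ℓ ^ γ) ^ (4 * m) + 1) + Ck, fun n hn => ?_⟩
  have hσ := scale_pos hℓ β hn
  set σ := scale ℓ β n with hσdef
  set ε := (n : ℝ) ^ (-(γ / (2 * β))) with hε
  have hn₀ : (0 : ℝ) < n := by exact_mod_cast hn
  have hε₀ : 0 < ε := by positivity
  have hε₁ : ε ≤ 1 := rpow_neg_natCast_le_one (by positivity) hn
  have hσγ : σ ^ γ = ℓ ^ γ * ε := scale_rpow hℓ β γ n
  have hσβ : 0 < σ ^ β := Real.rpow_pos_of_pos hσ β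
  have mM := (hF.approx_normality.measurable n hn).comp mt
  have mΔ := (hΔm n hn).comp mt
  have mL := (hLm n hn).comp mt
  obtain ⟨iL, bL⟩ := hF.density₁.integrable_of_lintegral_le (P := P) hF.density₂
    (G := fun z => |L n z.2.1 z.2.2 z.1 - 1| ^ (4 * m))
    ((_root_.continuous_abs.measurable.comp (mL.sub_const 1)).pow_const _)
    (fun z => by positivity) (by positivity) (hLle n hn)
  obtain ⟨iΔ, bΔ⟩ := hF.density₁.integrable_of_lintegral_le (P := P) hF.density₂
    (G := fun z => |Δ n z.2.1 z.2.2 z.1| ^ (8 * m))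
    ((_root_.continuous_abs.measurable.comp mΔ).pow_const _)
    (fun z => by positivity) (by positivity) (hΔle n hn)
  beta_reduce at bL bΔ
  obtain ⟨hWG, -, -⟩ := hfield n hn
  obtain ⟨iX, bX⟩ := hWG.integral_pow_two_mul_le hw (4 * m)
  have e8 : 2 * (4 * m) = 8 * m := by ring
  have eX : ∀ y : ℝ, y ^ (2 * (4 * m)) = |y| ^ (8 * m) := fun y => by
    rw [← e8, (even_two_mul _).pow_abs]
  have eD : ∀ z : Ω × (ℝ × ℝ), |normalisedField ℓ β Δ n z.2 z.1| ^ (8 * m) =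
      ((σ ^ β)⁻¹) ^ (8 * m) * |Δ n z.2.1 z.2.2 z.1| ^ (8 * m) := fun z => by
    rw [normalisedField, abs_mul, mul_pow, abs_of_pos (inv_pos.2 hσβ)]
  have key := integral_perturbed_sq_pow_le (κ := P.prod (pointMeasure ν₁ ν₂))
    (X := fun z => normalisedField ℓ β M n z.2 z.1)
    (D := fun z => normalisedField ℓ β Δ n z.2 z.1) (L := fun z => L n z.2.1 z.2.2 z.1)
    (K := fun z => K z.2.1 z.1) (a := A) (b := CΔ * (ℓ ^ γ) ^ (8 * m))
    (c := CL * (ℓ ^ γ) ^ (4 * m)) (k := Ck)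
    (mM.const_mul _) (mΔ.const_mul _) mL hF.measurable_field (m := m) hε₀ hε₁
    (by simp only [← eX]; exact iX) (by simp only [eD]; exact iΔ.const_mul _) iL
    hF.integrable_exp_field (by simp only [← eX]; exact bX)
    (by
      simp only [eD]
      rw [integral_const_mul]
      refine (mul_le_mul_of_nonneg_left bΔ (by positivity)).trans (le_of_eq ?_)
      -- Division by σ^β removes the part 8mβ of the exponent; what is left is ε^(8m) up to a power
      -- of ℓ^γ.
      have e₁ : σ ^ (8 * (m : ℝ) * β + 8 * (m : ℝ) * γ) =
          (σ ^ β) ^ (8 * m) * (ℓ ^ γ * ε) ^ (8 * m) := by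
        rw [← hσγ, Real.rpow_add hσ, ← Real.rpow_natCast, ← Real.rpow_natCast,
          ← Real.rpow_mul hσ.le, ← Real.rpow_mul hσ.le]
        push_cast
        ring_nf
      rw [← hσdef, e₁, mul_pow, inv_pow]
      field_simp)
    (by
      refine bL.trans (le_of_eq ?_)
      have e₁ : σ ^ (4 * (m : ℝ) * γ) = (ℓ ^ γ * ε) ^ (4 * m) := by
        rw [← hσγ, ← Real.rpow_natCast, ← Real.rpow_mul hσ.le]
        push_cast
        ring_nf
      rw [← hσdef, e₁, mul_pow]
      ring)
    le_rfl
  have e : (n : ℝ) ^ (-(γ / (2 * β) * m)) = ε ^ m := by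
    rw [hε, ← Real.rpow_natCast, ← Real.rpow_mul hn₀.le, neg_mul]
  rw [e]
  exact key

theorem ae_perturbationError [IsProbabilityMeasure P] {L Δ : ℕ → ℝ → ℝ → Ω → ℝ}
    (hLm : ∀ n : ℕ, 1 ≤ n → Measurable (fun t : ℝ × ℝ × Ω => L n t.1 t.2.1 t.2.2))
    (hL : Precsim
      (fun n => ∫⁻ p : ℝ × ℝ, (∫⁻ ω, ENNReal.ofReal (|L n p.1 p.2 ω - 1| ^ (4 * m)) ∂P) *
        ENNReal.ofReal (ν₁ p.1 * ν₂ p.2))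
      (fun n => scale ℓ β n ^ (4 * (m : ℝ) * γ)))
    (hΔm : ∀ n : ℕ, 1 ≤ n → Measurable (fun t : ℝ × ℝ × Ω => Δ n t.1 t.2.1 t.2.2))
    (hΔ : Precsim
      (fun n => ∫⁻ p : ℝ × ℝ, (∫⁻ ω, ENNReal.ofReal (|Δ n p.1 p.2 ω| ^ (8 * m)) ∂P) *
        ENNReal.ofReal (ν₁ p.1 * ν₂ p.2))
      (fun n => scale ℓ β n ^ (8 * (m : ℝ) * β + 8 * (m : ℝ) * γ))) :
    ∀ᵐ ω ∂P, (∀ n : ℕ, 1 ≤ n →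
        Integrable (perturbationError ℓ β K M L Δ n ω) (pointMeasure ν₁ ν₂)) ∧
      Tendsto (fun n => ∫ t, perturbationError ℓ β K M L Δ n ω t ∂(pointMeasure ν₁ ν₂))
        atTop (𝓝 0) := by
  have := hF.isProbabilityMeasure_pointMeasure
  obtain ⟨-, -, -, -, hs⟩ := one_lt_exponents hF.beta_pos hF.gamma_pos hF.m_large
  have hβ := hF.beta_pos
  have hγ := hF.gamma_pos
  have hm : 1 ≤ m := by
    rcases Nat.eq_zero_or_pos m with h | h
    · simp [h] at hs
      linarith
    · exact h
  obtain ⟨C, hmom⟩ := hF.exists_integral_perturbationError_pow_le hLm hL hΔm hΔ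
  exact ae_tendsto_integral_of_integral_pow_le
    (fun n hn => hF.measurable_perturbationError hn (hLm n hn) (hΔm n hn)) hm hs hmom

end AnomalousScalingFramework

end ScalingFramework

/-! ### Normalising the target, and the second moment in the coordinates (x, z) -/

theorem logMHRatio_div_const (f : ℝ → ℝ) (q : ℝ → ℝ → ℝ) {Z : ℝ} (hZ : 0 < Z) (x y : ℝ) :
    logMHRatio (fun u => f u / Z) q x y = logMHRatio f q x y := by
  have h : ∀ a b : ℝ, a / Z * b = a * b / Z := fun a b => by ring
  -- Dividing by Z > 0 leaves both positivity tests unchanged, so the default value 0 is taken at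
  -- the same pairs; elsewhere Z cancels in the quotient.
  simp only [logMHRatio, h, div_pos_iff_of_pos_right hZ, div_div_div_cancel_right₀ hZ.ne']

theorem sqRatioIntegrand_div_const (f : ℝ → ℝ) (q : ℝ → ℝ → ℝ) {Z : ℝ} (hZ : 0 < Z) (p : ℝ × ℝ) :
    sqRatioIntegrand (fun u => f u / Z) q p = sqRatioIntegrand f q p / Z := by
  rw [sqRatioIntegrand, sqRatioIntegrand, logMHRatio_div_const f q hZ]
  ring

/-- In the coordinates `y = x + σ z`, the second moment of the log acceptance ratio is an integral
with respect to the product of the measures with densities `ν₁` and `ν₂`. -/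
theorem IsDensityWithMoments.sqRatioMoment_eq {ν₁ ν₂ : ℝ → ℝ} (h₁ : IsDensityWithMoments ν₁)
    (h₂ : IsDensityWithMoments ν₂) {f : ℝ → ℝ} {q : ℝ → ℝ → ℝ} {σ c : ℝ} (hσ : 0 < σ)
    {G : ℝ × ℝ → ℝ} (hG : Integrable G (pointMeasure ν₁ ν₂))
    (he : ∀ᵐ p : ℝ × ℝ, σ * sqRatioIntegrand f q (p.1, p.1 + σ * p.2) =
      c * (G p * (ν₁ p.1 * ν₂ p.2))) :
    Integrable (sqRatioIntegrand f q) ∧ sqRatioMoment f q = c * ∫ p, G p ∂(pointMeasure ν₁ ν₂) := by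
  constructor
  · rw [← integrable_comp_shearScale_iff hσ.ne', ← integrable_const_mul_iff hσ.ne'.isUnit]
    exact ((((h₁.integrable_prod_iff h₂).1 hG)).const_mul c).congr (he.mono fun p hp => hp.symm)
  · rw [sqRatioMoment, integral_comp_shearScale hσ, integral_congr_ae he, integral_const_mul,
      h₁.integral_prod_eq h₂]

/-! ### Convergence for almost every environment -/

section Realisation

variable {Ω : Type*} [MeasurableSpace Ω] {P : Measure Ω}

/-- The assumptions give a null event for each point. Joint measurability and Fubini exchange the
quantifiers: one null event for all n, outside which the identity fails only on a null set of
points, invisible to the integrals. -/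
theorem ae_forall_ae_eq [SFinite P] {f g : ℕ → ℝ × ℝ → Ω → ℝ}
    (hf : ∀ n, 1 ≤ n → Measurable fun z : Ω × (ℝ × ℝ) => f n z.2 z.1)
    (hg : ∀ n, 1 ≤ n → Measurable fun z : Ω × (ℝ × ℝ) => g n z.2 z.1)
    (hfg : ∀ n, 1 ≤ n → ∀ p, ∀ᵐ ω ∂P, f n p ω = g n p ω) :
    ∀ᵐ ω ∂P, ∀ n, 1 ≤ n → ∀ᵐ p : ℝ × ℝ, f n p ω = g n p ω := by
  rw [ae_all_iff]
  intro n
  by_cases hn : 1 ≤ n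
  · have := (Measure.ae_ae_comm (μ := P) (ν := (volume : Measure (ℝ × ℝ)))
      (p := fun ω p => f n p ω = g n p ω) (measurableSet_eq_fun (hf n hn) (hg n hn))).2
      (ae_of_all _ (hfg n hn))
    exact this.mono fun ω h _ => h
  · exact ae_of_all _ fun ω h => absurd h hn

theorem measurable_envLogRatio {ν₁ : ℝ → ℝ} {K : ℝ → Ω → ℝ} {q : ℕ → ℝ → ℝ → Ω → ℝ} {n : ℕ}
    (hν : Measurable ν₁) (hK : Measurable fun t : ℝ × Ω => K t.1 t.2)
    (hq : Measurable fun t : ℝ × ℝ × Ω => q n t.1 t.2.1 t.2.2) :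
    Measurable fun t : ℝ × ℝ × Ω => envLogRatio ν₁ K q n t.1 t.2.1 t.2.2 := by
  have hξ : Measurable fun t : ℝ × Ω => unnormTarget ν₁ K t.2 t.1 :=
    hK.exp.mul (hν.comp measurable_fst)
  have ha : Measurable fun t : ℝ × ℝ × Ω =>
      unnormTarget ν₁ K t.2.2 t.1 * q n t.1 t.2.1 t.2.2 :=
    (hξ.comp (by fun_prop : Measurable fun t : ℝ × ℝ × Ω => (t.1, t.2.2))).mul hq
  have hb : Measurable fun t : ℝ × ℝ × Ω =>
      unnormTarget ν₁ K t.2.2 t.2.1 * q n t.2.1 t.1 t.2.2 :=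
    ha.comp (by fun_prop : Measurable fun t : ℝ × ℝ × Ω => (t.2.1, t.1, t.2.2))
  exact Measurable.ite ((measurableSet_lt measurable_const ha).inter
    (measurableSet_lt measurable_const hb)) (hb.div ha).log measurable_const

variable {ν₁ ν₂ : ℝ → ℝ} {β γ ℓ : ℝ} {m : ℕ}
  {K : ℝ → Ω → ℝ} {q M : ℕ → ℝ → ℝ → Ω → ℝ} {h : ℝ → ℝ → ℝ}

namespace AnomalousScalingFramework

variable (hF : AnomalousScalingFramework P ν₁ ν₂ β γ ℓ m K q M h)

include hF

/-- All three integrands are dominated by the envelope, whose first moment is finite on the product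
space, hence finite for almost every environment. -/
theorem ae_integrable_mul_exp [IsProbabilityMeasure P] :
    ∀ᵐ ω ∂P, Integrable (fun t : ℝ × ℝ => Real.exp (K t.1 ω)) (pointMeasure ν₁ ν₂) ∧
      Integrable (fun t : ℝ × ℝ => h t.1 t.2 * Real.exp (K t.1 ω)) (pointMeasure ν₁ ν₂) ∧
      ∀ n : ℕ, 1 ≤ n → Integrable
        (fun t => normalisedField ℓ β M n t ω ^ 2 * Real.exp (K t.1 ω)) (pointMeasure ν₁ ν₂) := by
  have := hF.isProbabilityMeasure_pointMeasure
  have hm : 1 ≤ m := by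
    have := (one_lt_exponents hF.beta_pos hF.gamma_pos hF.m_large).1
    omega
  obtain ⟨w, _, -, hw, hfield⟩ := hF.exists_weight
  obtain ⟨C, hC⟩ := exists_integral_fieldEnvelope_pow_le (K := fun t : ℝ × ℝ => K t.1)
    hw hm hF.integrable_exp_field
  have hE : ∀ᵐ ω ∂P, ∀ n : ℕ, 1 ≤ n → Integrable (fun t => fieldEnvelope (normalisedField ℓ β M n)
      (fun t => K t.1) w t ω) (pointMeasure ν₁ ν₂) := by
    rw [ae_all_iff]
    intro n
    by_cases hn : 1 ≤ n
    · filter_upwards [(hC _ (hfield n hn).1).1.prod_right_ae] with ω hω _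
      simpa only [pow_one] using hω
    · exact ae_of_all _ fun ω h => absurd h hn
  filter_upwards [hE] with ω hω
  have hWG := fun n hn => (hfield n hn).1
  have mK : Measurable fun t : ℝ × ℝ => Real.exp (K t.1 ω) :=
    ((hWG 1 le_rfl).measurable_right.comp (measurable_const.prodMk measurable_id)).exp
  have mX : ∀ n : ℕ, 1 ≤ n → Measurable fun t => normalisedField ℓ β M n t ω := fun n hn =>
    (hWG n hn).measurable_left.comp (measurable_const.prodMk measurable_id)
  have hle : ∀ n : ℕ, 1 ≤ n → ∀ (t : ℝ × ℝ) (a : ℝ), 0 ≤ a →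
      a ≤ 1 + normalisedField ℓ β M n t ω ^ 2 + w t ^ 2 →
      ‖a * Real.exp (K t.1 ω)‖ ≤
        fieldEnvelope (normalisedField ℓ β M n) (fun t => K t.1) w t ω := by
    intro n hn t a ha hat
    rw [Real.norm_of_nonneg (by positivity), fieldEnvelope]
    gcongr
    have h₁ := (hWG n hn).one_le_weight t
    have h₂ : 0 ≤ 1 + normalisedField ℓ β M n t ω ^ 2 + w t ^ 2 := by positivity
    nlinarith
  -- Measurability and nonnegativity of h are not assumed; both follow because h is the variance of
  -- the normalised field at n = 1.
  have e : ∀ t : ℝ × ℝ, h t.1 t.2 = Var[normalisedField ℓ β M 1 t; P] := fun t =>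
    (hF.variance_normalisedField le_rfl t).symm
  refine ⟨(hω 1 le_rfl).mono' mK.aestronglyMeasurable (ae_of_all _ fun t => ?_),
    (hω 1 le_rfl).mono' ?_ (ae_of_all _ fun t => hle 1 le_rfl t _ ?_ ?_), fun n hn =>
    (hω n hn).mono' (((mX n hn).pow_const 2).mul mK).aestronglyMeasurable
      (ae_of_all _ fun t => hle n hn t _ (sq_nonneg _) ?_)⟩
  · have := hle 1 le_rfl t 1 zero_le_one
      (by nlinarith [sq_nonneg (w t), sq_nonneg (normalisedField ℓ β M 1 t ω)])
    rwa [one_mul] at this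
  · simp only [e]
    exact ((hWG 1 le_rfl).measurable_variance.mul mK).aestronglyMeasurable
  · rw [e]
    exact variance_nonneg _ _
  · rw [e]
    nlinarith [(hWG 1 le_rfl).variance_le t, sq_nonneg (normalisedField ℓ β M 1 t ω)]
  · nlinarith [sq_nonneg (w t)]

/-- Integrability and positivity of the mass of the unnormalised target density. -/
theorem integrable_unnormTarget {ω : Ω}
    (hω : Integrable (fun t : ℝ × ℝ => Real.exp (K t.1 ω)) (pointMeasure ν₁ ν₂)) :
    Integrable (unnormTarget ν₁ K ω) ∧ 0 < ∫ x, unnormTarget ν₁ K ω x := by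
  have := hF.density₁.isProbabilityMeasure
  have := hF.density₂.isProbabilityMeasure
  have mK : Measurable fun x => Real.exp (K x ω) :=
    (hF.perturbation.measurable.comp (measurable_id.prodMk measurable_const)).exp
  have hi : Integrable (unnormTarget ν₁ K ω) := by
    refine hF.density₁.integrable_densityMeasure_iff.1 ?_
    exact (Integrable.comp_fst_iff (IsProbabilityMeasure.ne_zero _)).1 hω
  have h₀ : ∀ x, 0 ≤ unnormTarget ν₁ K ω x := fun x =>
    mul_nonneg (Real.exp_pos _).le (hF.density₁.nonneg x)
  refine ⟨hi, (integral_nonneg h₀).lt_of_ne fun hz => ?_⟩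
  have hz' := (integral_eq_zero_iff_of_nonneg h₀ hi).1 hz.symm
  have : ∫ x, ν₁ x = 0 := integral_eq_zero_of_ae <| hz'.mono fun x hx =>
    (mul_eq_zero.1 hx).resolve_left (Real.exp_pos _).ne'
  rw [hF.density₁.integral_eq_one] at this
  exact one_ne_zero this

/-- On one almost sure event the rescaled moment is, for every n ≥ 1, the integrated perturbation
error plus the average of the centred square plus the limit itself. -/
theorem ae_tendsto_sqRatioMoment [IsProbabilityMeasure P] :
    ∀ᵐ ω ∂P, (Integrable (unnormTarget ν₁ K ω) ∧ 0 < ∫ x, unnormTarget ν₁ K ω x) ∧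
      (∀ n : ℕ, 1 ≤ n →
        Integrable (sqRatioIntegrand (unnormTarget ν₁ K ω) (fun x y => q n x y ω))) ∧
      Integrable (fun p : ℝ × ℝ => h p.1 p.2 * unnormTarget ν₁ K ω p.1 * ν₂ p.2) ∧
      Tendsto
        (fun n : ℕ => scale ℓ β n ^ (-(2 * β)) *
          sqRatioMoment (unnormTarget ν₁ K ω) (fun x y => q n x y ω))
        atTop
        (𝓝 (∫ p : ℝ × ℝ, h p.1 p.2 * unnormTarget ν₁ K ω p.1 * ν₂ p.2)) := by
  obtain ⟨L, hLm, hLe, hL⟩ := hF.proposal_asymptotics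
  obtain ⟨Δ, hΔm, hΔe, hΔ⟩ := hF.approx_normality.remainder
  have mt : Measurable fun p : Ω × ℝ × ℝ => (p.2.1, p.2.2, p.1) := by fun_prop
  have ms : ∀ n, Measurable fun p : Ω × ℝ × ℝ =>
      (p.2.1, p.2.1 + scale ℓ β n * p.2.2, p.1) := fun n => by fun_prop
  have mν₂ : Measurable fun p : Ω × ℝ × ℝ => ν₂ p.2.2 :=
    hF.density₂.measurable.comp (by fun_prop)
  have hq := ae_forall_ae_eq (P := P)
    (f := fun n p ω => scale ℓ β n * q n p.1 (p.1 + scale ℓ β n * p.2) ω)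
    (g := fun n p ω => L n p.1 p.2 ω * ν₂ p.2)
    (fun n hn => ((hF.proposal.measurable n hn).comp (ms n)).const_mul _)
    (fun n hn => ((hLm n hn).comp mt).mul mν₂) (fun n hn p => hLe n hn p.1 p.2)
  have hρ := ae_forall_ae_eq (P := P)
    (f := fun n p ω => envLogRatio ν₁ K q n p.1 (p.1 + scale ℓ β n * p.2) ω)
    (g := fun n p ω => M n p.1 p.2 ω + Δ n p.1 p.2 ω)
    (fun n hn => (measurable_envLogRatio hF.density₁.measurable hF.perturbation.measurable
      (hF.proposal.measurable n hn)).comp (ms n))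
    (fun n hn => ((hF.approx_normality.measurable n hn).comp mt).add ((hΔm n hn).comp mt))
    (fun n hn p => hΔe n hn p.1 p.2)
  filter_upwards [hq, hρ, hF.ae_integrable_mul_exp, hF.ae_tendsto_avgExpCentredSq,
    hF.ae_perturbationError hLm hL hΔm hΔ] with ω hqω hρω ⟨hi, hih, hiX⟩ hW ⟨hiE, hE⟩
  have eh : (fun p : ℝ × ℝ => h p.1 p.2 * unnormTarget ν₁ K ω p.1 * ν₂ p.2) =
      fun p => h p.1 p.2 * Real.exp (K p.1 ω) * (ν₁ p.1 * ν₂ p.2) := by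
    funext p
    simp only [unnormTarget]
    ring
  have key : ∀ n : ℕ, 1 ≤ n →
      Integrable (sqRatioIntegrand (unnormTarget ν₁ K ω) (fun x y => q n x y ω)) ∧
      sqRatioMoment (unnormTarget ν₁ K ω) (fun x y => q n x y ω) = scale ℓ β n ^ (2 * β) *
        ∫ p, (perturbationError ℓ β K M L Δ n ω p +
          normalisedField ℓ β M n p ω ^ 2 * Real.exp (K p.1 ω)) ∂(pointMeasure ν₁ ν₂) := by
    intro n hn
    have hσ := scale_pos hF.ell_pos β hn
    refine hF.density₁.sqRatioMoment_eq hF.density₂ hσ ((hiE n hn).add (hiX n hn)) ?_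
    filter_upwards [hqω n hn, hρω n hn] with p h₁ h₂
    have hσβ : scale ℓ β n ^ β ≠ 0 := (Real.rpow_pos_of_pos hσ β).ne'
    have e₂ : scale ℓ β n ^ (2 * β) = (scale ℓ β n ^ β) ^ 2 := by
      rw [← Real.rpow_natCast, ← Real.rpow_mul hσ.le, mul_comm 2 β]
      norm_num
    rw [envLogRatio] at h₂
    -- The Jacobian σ combines with q into L ν₂ and the target contributes e^K ν₁; extracting σ^{2β}
    -- leaves the normalised field and remainder.
    calc scale ℓ β n * sqRatioIntegrand (unnormTarget ν₁ K ω) (fun x y => q n x y ω)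
          (p.1, p.1 + scale ℓ β n * p.2)
        = (M n p.1 p.2 ω + Δ n p.1 p.2 ω) ^ 2 * unnormTarget ν₁ K ω p.1 *
          (scale ℓ β n * q n p.1 (p.1 + scale ℓ β n * p.2) ω) := by
          rw [sqRatioIntegrand]
          simp only [h₂]
          ring
      _ = _ := by
          simp only [h₁, e₂, unnormTarget, perturbationError, normalisedField]
          field_simp
          ring
  refine ⟨hF.integrable_unnormTarget hi, fun n hn => (key n hn).1, ?_, ?_⟩
  · rw [eh]
    exact (hF.density₁.integrable_prod_iff hF.density₂).1 hih
  · rw [eh, ← hF.density₁.integral_prod_eq hF.density₂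
      (fun p => h p.1 p.2 * Real.exp (K p.1 ω))]
    have hlim := (hE.add hW).add_const
      (∫ p, h p.1 p.2 * Real.exp (K p.1 ω) ∂(pointMeasure ν₁ ν₂))
    rw [add_zero, zero_add] at hlim
    refine hlim.congr' ?_
    filter_upwards [eventually_ge_atTop 1] with n hn
    have hσ := scale_pos hF.ell_pos β hn
    have eW : avgExpCentredSq P (pointMeasure ν₁ ν₂) (normalisedField ℓ β M n)
        (fun t => K t.1) ω =
        ∫ p, normalisedField ℓ β M n p ω ^ 2 * Real.exp (K p.1 ω) ∂(pointMeasure ν₁ ν₂) -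
          ∫ p, h p.1 p.2 * Real.exp (K p.1 ω) ∂(pointMeasure ν₁ ν₂) := by
      rw [avgExpCentredSq, ← integral_sub (hiX n hn) hih]
      simp only [expCentredSq, hF.variance_normalisedField hn, sub_mul]
    rw [(key n hn).2, ← mul_assoc, ← Real.rpow_add hσ, neg_add_cancel, Real.rpow_zero, one_mul,
      integral_add (hiE n hn) (hiX n hn), eW]
    ring

end AnomalousScalingFramework

end Realisation

/-! ### The theorem -/

theorem mainTheorem9 {Ω : Type*} [MeasurableSpace Ω] (P : Measure Ω) [IsProbabilityMeasure P]
    (ν₁ ν₂ : ℝ → ℝ) (β γ ℓ : ℝ) (m : ℕ)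
    (K : ℝ → Ω → ℝ) (q M : ℕ → ℝ → ℝ → Ω → ℝ) (h : ℝ → ℝ → ℝ)
    (hF : AnomalousScalingFramework P ν₁ ν₂ β γ ℓ m K q M h) :
    ∀ᵐ ω ∂P,
      -- the unnormalised target can be normalised
      (Integrable (unnormTarget ν₁ K ω) ∧ 0 < ∫ x, unnormTarget ν₁ K ω x) ∧
      -- the unnormalised second moment
      ((∀ n : ℕ, 1 ≤ n →
          Integrable (sqRatioIntegrand (unnormTarget ν₁ K ω) (fun x y => q n x y ω))) ∧
        Integrable (fun p : ℝ × ℝ => h p.1 p.2 * unnormTarget ν₁ K ω p.1 * ν₂ p.2) ∧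
        Tendsto
          (fun n : ℕ => scale ℓ β n ^ (-(2 * β)) *
            sqRatioMoment (unnormTarget ν₁ K ω) (fun x y => q n x y ω))
          atTop
          (𝓝 (∫ p : ℝ × ℝ, h p.1 p.2 * unnormTarget ν₁ K ω p.1 * ν₂ p.2))) ∧
      -- the normalised second moment
      ((∀ n : ℕ, 1 ≤ n →
          Integrable (sqRatioIntegrand (normTarget ν₁ K ω) (fun x y => q n x y ω))) ∧
        Integrable (fun p : ℝ × ℝ => h p.1 p.2 * normTarget ν₁ K ω p.1 * ν₂ p.2) ∧
        Tendsto
          (fun n : ℕ => scale ℓ β n ^ (-(2 * β)) *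
            sqRatioMoment (normTarget ν₁ K ω) (fun x y => q n x y ω))
          atTop
          (𝓝 (∫ p : ℝ × ℝ, h p.1 p.2 * normTarget ν₁ K ω p.1 * ν₂ p.2))) := by
  filter_upwards [hF.ae_tendsto_sqRatioMoment] with ω ⟨⟨hi, hpos⟩, hI, hh, hlim⟩
  have hf : normTarget ν₁ K ω =
      fun u => unnormTarget ν₁ K ω u / ∫ x, unnormTarget ν₁ K ω x := rfl
  have e₁ : ∀ n, sqRatioIntegrand (normTarget ν₁ K ω) (fun x y => q n x y ω) = fun p =>
      sqRatioIntegrand (unnormTarget ν₁ K ω) (fun x y => q n x y ω) p /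
        ∫ x, unnormTarget ν₁ K ω x :=
    fun n => funext fun p => by rw [hf, sqRatioIntegrand_div_const _ _ hpos]
  have e₂ : (fun p : ℝ × ℝ => h p.1 p.2 * normTarget ν₁ K ω p.1 * ν₂ p.2) = fun p =>
      h p.1 p.2 * unnormTarget ν₁ K ω p.1 * ν₂ p.2 / ∫ x, unnormTarget ν₁ K ω x := by
    funext p
    rw [hf]
    ring
  refine ⟨⟨hi, hpos⟩, ⟨hI, hh, hlim⟩, fun n hn => ?_, ?_, ?_⟩
  · rw [e₁]
    exact (hI n hn).div_const _
  · rw [e₂]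
    exact hh.div_const _
  · simp only [sqRatioMoment] at hlim ⊢
    simp only [e₁]
    rw [e₂]
    simp only [integral_div, ← mul_div_assoc]
    exact hlim.div_const _
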